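/- Setting. Let $M$ be a first-order structure in a language $\mathcal L$, let $\kappa>|M|$ be an infinite cardinal and let $\mathfrak C\succeq M$ be a $\kappa$-saturated elementary extension (for instance a monster model). Let $G$ be a group $\emptyset$-definable in $M$ (its universe being a set of $n$-tuples), and let $G^*$ be its interpretation in $\mathfrak C$, so $G\le G^*$. Let $\Delta$ be a set of $\mathcal L$-formulas $\delta(x;y,z,\bar t)$ of the form $\psi(y\cdot x\cdot z;\bar t)$, where $y,z$ range over the group. A subset of $G^*$ is $\Delta$-definable over $A\subseteq\mathfrak C$ if it is a Boolean combination (inside $G^*$) of sets defined by instances of formulas from $\Delta$ with parameters from $\operatorname{dcl}(A)$. (Since all sets are taken relative to $G^*$, it makes no difference whether the formula $G(y\cdot x\cdot z)$ belongs to $\Delta$.) $S_{G,\Delta}(M)$ is the Stone space of complete $\Delta$-types over $M$ concentrating on $G$, i.e. of ultrafilters of the Boolean algebra of sets $\Delta$-definable over $M$, and $\operatorname{tp}_\Delta(a/A)$ is the complete $\Delta$-type of $a\in G^*$ over $A$. Type-definable over $M$ means: an intersection of $M$-definable sets. Flows. A $\Delta$-definable $G$-ambit $(G,X,x_0)$ consists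 of an action of $G$ by homeomorphisms on a compact Hausdorff space $X$ and a point $x_0$ with dense orbit, such that for every $x\in X$ the map $g\mapsto gx$ is $\Delta$-definable, i.e. the preimages in $G$ of any two disjoint closed subsets of $X$ are separated by the trace on $G$ of a set $\Delta$-definable over $M$. It is universal if for every $\Delta$-definable $G$-ambit $(G,Y,y_0)$ there is a unique continuous $G$-equivariant map $X\to Y$ with $x_0\mapsto y_0$. Let $(G,\mathcal U,x)$ be a universal $\Delta$-definable $G$-ambit. Let $h\colon S_{G,\Delta}(M)\to\mathcal U$ be the continuous map for which $a\mapsto h(\operatorname{tp}_\Delta(a/M))$ is the unique extension of $G\ni g\mapsto gx$ to a map $G^*\to\mathcal U$ that is $\Delta$-definable over $M$ (preimages of closed sets are intersections of sets $\Delta$-definable over $M$). Define $E_\Delta(p,q)\iff h(p)=h(q)$, and $E'_\Delta(a,b)\iff E_\Delta(\operatorname{tp}_\Delta(a/M),\operatorname{tp}_\Delta(b/M))$ for $a,b\in G^*$. The relation $\bar F_\Delta$. For $\alpha,\beta\in G^*$ let $F_{0\Delta}(\alpha,\beta)$ hold if there are $a,b,a_1,b_1\in G^*$ with $\alpha=ab$,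 $\beta=a_1b_1$, $\operatorname{tp}_\Delta(a/M)=\operatorname{tp}_\Delta(a_1/M)$, $\operatorname{tp}_\Delta(b/M)=\operatorname{tp}_\Delta(b_1/M)$, and both $\operatorname{tp}_\Delta(a/M,b)$ and $\operatorname{tp}_\Delta(a_1/M,b_1)$ finitely satisfiable in $M$. Let $F_\Delta$ be the transitive closure of $F_{0\Delta}$, and $\bar F_\Delta$ the finest equivalence relation on $G^*$ that is type-definable over $M$ and contains $F_\Delta$. Equip $G^*/\bar F_\Delta$ with the logic topology: a set is closed iff its preimage in $G^*$ is type-definable over $M$. Theorem. $\bar F_\Delta=E'_\Delta$ (with $h$ above existing). Consequently $G$ acts on $G^*/\bar F_\Delta$ by $g(a/\bar F_\Delta)=(ga)/\bar F_\Delta$, and with this action $(G,G^*/\bar F_\Delta,e/\bar F_\Delta)$ is the universal $\Delta$-definable $G$-ambit. -/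

import Mathlib

open FirstOrder FirstOrder.Language

universe u v w s t

namespace DeltaFlow

variable {L : FirstOrder.Language.{u, v}} {C : Type w} [L.Structure C]

/-! ### Saturation, definable closure -/

/-- `C` is `κ`-saturated: every set of formulas in finitely many variables over a set of fewer than
`κ` parameters which is finitely satisfiable in `C` is satisfiable in `C`. -/
def IsSaturated (L : FirstOrder.Language.{u, v}) (C : Type w) [L.Structure C]
    (κ : Cardinal.{w}) : Prop :=
  ∀ A : Set C, Cardinal.mk A < κ → ∀ (m : ℕ) (Φ : Set (L[[A]].Formula (Fin m))),
    (∀ Φ₀ : Finset (L[[A]].Formula (Fin m)), (Φ₀ : Set (L[[A]].Formula (Fin m))) ⊆ Φ →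
      ∃ x : Fin m → C, ∀ φ ∈ Φ₀, φ.Realize x) →
    ∃ x : Fin m → C, ∀ φ ∈ Φ, φ.Realize x

/-- The definable closure of `A`: the elements `c` such that `{c}` is definable over `A`. -/
def dcl (L : FirstOrder.Language.{u, v}) {C : Type w} [L.Structure C] (A : Set C) : Set C :=
  {c | A.Definable₁ L {c}}

/-! ### Definable groups and their interpretation in an elementary extension -/

/-- The formulas `dom(x)` and `mul(x, y, z)` (without parameters, `x, y, z` being `n`-tuples of
variables) define in the structure `N` a set and the graph of a group operation on that set. -/
structure IsGroupOn (N : Type*) [L.Structure N] {n : ℕ} (dom : L.Formula (Fin n))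
    (mul : L.Formula (Fin n ⊕ (Fin n ⊕ Fin n))) : Prop where
  exists_mul : ∀ a b : Fin n → N, dom.Realize a → dom.Realize b →
    ∃ c : Fin n → N, dom.Realize c ∧ mul.Realize (Sum.elim a (Sum.elim b c))
  mul_unique : ∀ a b c d : Fin n → N, dom.Realize a → dom.Realize b → dom.Realize c →
    dom.Realize d → mul.Realize (Sum.elim a (Sum.elim b c)) →
    mul.Realize (Sum.elim a (Sum.elim b d)) → c = d
  mul_assoc : ∀ a b c ab bc abc : Fin n → N, dom.Realize a → dom.Realize b → dom.Realize c →
    dom.Realize ab → dom.Realize bc → dom.Realize abc →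
    mul.Realize (Sum.elim a (Sum.elim b ab)) → mul.Realize (Sum.elim b (Sum.elim c bc)) →
    mul.Realize (Sum.elim ab (Sum.elim c abc)) → mul.Realize (Sum.elim a (Sum.elim bc abc))
  exists_one : ∃ e : Fin n → N, dom.Realize e ∧ ∀ a : Fin n → N, dom.Realize a →
    mul.Realize (Sum.elim e (Sum.elim a a)) ∧
    ∃ b : Fin n → N, dom.Realize b ∧ mul.Realize (Sum.elim b (Sum.elim a e))

theorem realize_coe (M : L.ElementarySubstructure C) {α : Type*} (φ : L.Formula α) (x : α → M) :
    φ.Realize (fun i => (x i : C)) ↔ φ.Realize x :=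
  M.subtype.map_formula φ x

theorem mul_realize_coe (M : L.ElementarySubstructure C) {α : Type*}
    (φ : L.Formula (α ⊕ (α ⊕ α))) (x y z : α → M) :
    φ.Realize (Sum.elim (fun i => (x i : C))
      (Sum.elim (fun i => (y i : C)) (fun i => (z i : C)))) ↔
    φ.Realize (Sum.elim x (Sum.elim y z)) := by
  rw [← realize_coe M φ]
  apply iff_of_eq
  congr 1
  ext (i | i | i) <;> rfl

/-- A sentence expressing `IsGroupOn`. -/
theorem exists_sentence_isGroupOn {n : ℕ} (dom : L.Formula (Fin n))
    (mul : L.Formula (Fin n ⊕ (Fin n ⊕ Fin n))) :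
    ∃ φ : L.Formula Empty, ∀ (N : Type w) [L.Structure N],
      φ.Realize (default : Empty → N) ↔ IsGroupOn N dom mul := by
  let V (k : ℕ) := Empty ⊕ Fin k × Fin n
  let D {α : Type} (x : Fin n → α) : L.Formula α := dom.relabel x
  let T {α : Type} (x y z : Fin n → α) : L.Formula α := mul.relabel (Sum.elim x (Sum.elim y z))
  let X (k : ℕ) (i : Fin k) (j : Fin n) : V k := Sum.inr (i, j)
  have hD {α : Type} (x : Fin n → α) (N : Type w) [L.Structure N] (v : α → N) :
      (D x).Realize v ↔ dom.Realize (v ∘ x) := Formula.realize_relabel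
  have hT {α : Type} (x y z : Fin n → α) (N : Type w) [L.Structure N] (v : α → N) :
      (T x y z).Realize v ↔ mul.Realize (Sum.elim (v ∘ x) (Sum.elim (v ∘ y) (v ∘ z))) := by
    simp only [T, Formula.realize_relabel, Sum.comp_elim]
  let φ₁ : L.Formula Empty := Formula.iAlls (Fin 2 × Fin n)
    ((D (X 2 0)).imp ((D (X 2 1)).imp (Formula.iExs (Fin n)
      (D Sum.inr ⊓ T (Sum.inl ∘ X 2 0) (Sum.inl ∘ X 2 1) Sum.inr))))
  let φ₂ : L.Formula Empty := Formula.iAlls (Fin 4 × Fin n)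
    ((D (X 4 0)).imp ((D (X 4 1)).imp ((D (X 4 2)).imp ((D (X 4 3)).imp
      ((T (X 4 0) (X 4 1) (X 4 2)).imp ((T (X 4 0) (X 4 1) (X 4 3)).imp
        (Formula.iInf fun j => (Term.var (X 4 2 j)).equal (Term.var (X 4 3 j)))))))))
  let φ₃ : L.Formula Empty := Formula.iAlls (Fin 6 × Fin n)
    ((D (X 6 0)).imp ((D (X 6 1)).imp ((D (X 6 2)).imp ((D (X 6 3)).imp
      ((D (X 6 4)).imp ((D (X 6 5)).imp ((T (X 6 0) (X 6 1) (X 6 3)).imp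
        ((T (X 6 1) (X 6 2) (X 6 4)).imp ((T (X 6 3) (X 6 2) (X 6 5)).imp
          (T (X 6 0) (X 6 4) (X 6 5)))))))))))
  let φ₄ : L.Formula Empty := Formula.iExs (Fin n) (D Sum.inr ⊓ Formula.iAlls (Fin n)
    ((D Sum.inr).imp (T (Sum.inl ∘ Sum.inr) Sum.inr Sum.inr ⊓ Formula.iExs (Fin n)
      (D Sum.inr ⊓ T Sum.inr (Sum.inl ∘ Sum.inr) (Sum.inl ∘ Sum.inl ∘ Sum.inr)))))
  refine ⟨φ₁ ⊓ (φ₂ ⊓ (φ₃ ⊓ φ₄)), fun N _ => ?_⟩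
  have hX {k : ℕ} (d : Empty → N) (x : Fin k × Fin n → N) (i : Fin k) :
    (fun a => Sum.elim d x a) ∘ X k i = fun j => x (i, j) := rfl
  have hall {k : ℕ} (P : (Fin k → Fin n → N) → Prop) :
      (∀ x : Fin k × Fin n → N, P fun i j => x (i, j)) ↔ ∀ y, P y :=
    ⟨fun h y => h fun p => y p.1 p.2, fun h x => h _⟩
  have h₁ : φ₁.Realize (default : Empty → N) ↔ ∀ y : Fin 2 → Fin n → N,
      dom.Realize (y 0) → dom.Realize (y 1) →
      ∃ c : Fin n → N, dom.Realize c ∧ mul.Realize (Sum.elim (y 0) (Sum.elim (y 1) c)) := by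
    rw [← hall]
    simp only [φ₁, Formula.realize_iAlls, Formula.realize_imp, Formula.realize_iExs,
      Formula.realize_inf, hD, hT]
    rfl
  have h₂ : φ₂.Realize (default : Empty → N) ↔ ∀ y : Fin 4 → Fin n → N,
      dom.Realize (y 0) → dom.Realize (y 1) → dom.Realize (y 2) → dom.Realize (y 3) →
      mul.Realize (Sum.elim (y 0) (Sum.elim (y 1) (y 2))) →
      mul.Realize (Sum.elim (y 0) (Sum.elim (y 1) (y 3))) → y 2 = y 3 := by
    rw [← hall]
    simp only [φ₂, Formula.realize_iAlls, Formula.realize_imp, Formula.realize_iInf,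
      Formula.realize_equal, Term.realize_var, hD, hT, funext_iff]
    rfl
  have h₃ : φ₃.Realize (default : Empty → N) ↔ ∀ y : Fin 6 → Fin n → N,
      dom.Realize (y 0) → dom.Realize (y 1) → dom.Realize (y 2) → dom.Realize (y 3) →
      dom.Realize (y 4) → dom.Realize (y 5) →
      mul.Realize (Sum.elim (y 0) (Sum.elim (y 1) (y 3))) →
      mul.Realize (Sum.elim (y 1) (Sum.elim (y 2) (y 4))) →
      mul.Realize (Sum.elim (y 3) (Sum.elim (y 2) (y 5))) →
      mul.Realize (Sum.elim (y 0) (Sum.elim (y 4) (y 5))) := by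
    rw [← hall]
    simp only [φ₃, Formula.realize_iAlls, Formula.realize_imp, hD, hT]
    rfl
  have h₄ : φ₄.Realize (default : Empty → N) ↔ ∃ e : Fin n → N, dom.Realize e ∧
      ∀ a : Fin n → N, dom.Realize a → mul.Realize (Sum.elim e (Sum.elim a a)) ∧
      ∃ b : Fin n → N, dom.Realize b ∧ mul.Realize (Sum.elim b (Sum.elim a e)) := by
    simp only [φ₄, Formula.realize_iAlls, Formula.realize_imp, Formula.realize_iExs,
      Formula.realize_inf, hD, hT]
    rfl
  simp only [Formula.realize_inf, h₁, h₂, h₃, h₄]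
  constructor
  · rintro ⟨h1, h2, h3, h4⟩
    exact ⟨fun a b => h1 ![a, b], fun a b c d => h2 ![a, b, c, d],
      fun a b c d e f => h3 ![a, b, c, d, e, f], h4⟩
  · rintro ⟨h1, h2, h3, h4⟩
    exact ⟨fun y => h1 _ _, fun y => h2 _ _ _ _, fun y => h3 _ _ _ _ _ _, h4⟩

/-- Being a group is a first-order property of the pair of formulas. -/
theorem IsGroupOn.transfer (M : L.ElementarySubstructure C) {n : ℕ} {dom : L.Formula (Fin n)}
    {mul : L.Formula (Fin n ⊕ (Fin n ⊕ Fin n))} (h : IsGroupOn M dom mul) :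
    IsGroupOn C dom mul := by
  obtain ⟨φ, hφ⟩ := exists_sentence_isGroupOn dom mul
  rw [← hφ] at h ⊢
  have h' := (realize_coe M φ default).2 h
  rwa [Unique.eq_default (fun i : Empty => ((default : Empty → M) i : C))] at h'

/-- A group which is `∅`-definable in the elementary substructure `M` of `C`, with universe a set
of `n`-tuples. -/
structure DefinableGroup (M : L.ElementarySubstructure C) (n : ℕ) where
  dom : L.Formula (Fin n)
  mul : L.Formula (Fin n ⊕ (Fin n ⊕ Fin n))
  isGroup : IsGroupOn M dom mul

namespace DefinableGroup

variable {M : L.ElementarySubstructure C} {n : ℕ} (G : DefinableGroup M n)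

/-- `G*`, the interpretation of `G` in `C`. -/
def Star : Type w := {x : Fin n → C // G.dom.Realize x}

noncomputable instance : Mul G.Star where
  mul a b :=
    ⟨((G.isGroup.transfer M).exists_mul a.1 b.1 a.2 b.2).choose,
      ((G.isGroup.transfer M).exists_mul a.1 b.1 a.2 b.2).choose_spec.1⟩

noncomputable instance : One G.Star where
  one := ⟨(G.isGroup.transfer M).exists_one.choose,
    (G.isGroup.transfer M).exists_one.choose_spec.1⟩

noncomputable instance : Inv G.Star where
  inv a := ⟨((G.isGroup.transfer M).exists_one.choose_spec.2 a.1 a.2).2.choose,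
    ((G.isGroup.transfer M).exists_one.choose_spec.2 a.1 a.2).2.choose_spec.1⟩

theorem mul_realize (a b : G.Star) :
    G.mul.Realize (Sum.elim a.1 (Sum.elim b.1 (a * b).1)) :=
  ((G.isGroup.transfer M).exists_mul a.1 b.1 a.2 b.2).choose_spec.2

theorem mul_realize_iff (a b c : G.Star) :
    G.mul.Realize (Sum.elim a.1 (Sum.elim b.1 c.1)) ↔ a * b = c :=
  ⟨fun h => Subtype.ext ((G.isGroup.transfer M).mul_unique _ _ _ _ a.2 b.2 (a * b).2 c.2
    (G.mul_realize a b) h), fun h => h ▸ G.mul_realize a b⟩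

/-- The group structure of `G*`, given by the formula `mul` (see `mul_realize_iff`). -/
noncomputable instance : Group G.Star :=
  Group.ofLeftAxioms
    (fun a b c => ((G.mul_realize_iff _ _ _).1 ((G.isGroup.transfer M).mul_assoc a.1 b.1 c.1
      (a * b).1 (b * c).1 (a * b * c).1 a.2 b.2 c.2 (a * b).2 (b * c).2 (a * b * c).2
      (G.mul_realize _ _) (G.mul_realize _ _) (G.mul_realize _ _))).symm)
    (fun a => (G.mul_realize_iff _ _ _).1
      ((G.isGroup.transfer M).exists_one.choose_spec.2 a.1 a.2).1)
    (fun a => (G.mul_realize_iff _ _ _).1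
      ((G.isGroup.transfer M).exists_one.choose_spec.2 a.1 a.2).2.choose_spec.2)

theorem exists_base_one : ∃ (e : Fin n → M) (he : G.dom.Realize e),
    (⟨fun i => (e i : C), (realize_coe M G.dom e).2 he⟩ : G.Star) = (1 : G.Star) ∧
    ∀ a : Fin n → M, G.dom.Realize a → ∃ b : Fin n → M, G.dom.Realize b ∧
      G.mul.Realize (Sum.elim b (Sum.elim a e)) := by
  obtain ⟨e, he, h⟩ := G.isGroup.exists_one
  refine ⟨e, he, ?_, fun a ha => (h a ha).2⟩
  let e' : G.Star := ⟨fun i => (e i : C), (realize_coe M G.dom e).2 he⟩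
  have h' : e' * e' = e' :=
    (G.mul_realize_iff _ _ _).1 ((mul_realize_coe M G.mul e e e).2 (h e he).1)
  exact mul_eq_left.1 h'

/-- `G` itself, as the subgroup of `G*` of the elements with coordinates in `M`. -/
def base : Subgroup G.Star where
  carrier := {a | ∀ i, a.1 i ∈ M}
  mul_mem' := by
    intro a b ha hb
    obtain ⟨c, hc, h⟩ := G.isGroup.exists_mul (fun i => ⟨a.1 i, ha i⟩) (fun i => ⟨b.1 i, hb i⟩)
      ((realize_coe M G.dom _).1 a.2) ((realize_coe M G.dom _).1 b.2)
    have h' : a * b = ⟨fun i => (c i : C), (realize_coe M G.dom c).2 hc⟩ :=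
      (G.mul_realize_iff _ _ _).1 ((mul_realize_coe M G.mul _ _ c).2 h)
    intro i
    rw [h']
    exact (c i).2
  one_mem' := by
    obtain ⟨e, he, h, -⟩ := G.exists_base_one
    intro i
    rw [← h]
    exact (e i).2
  inv_mem' := by
    intro a ha
    obtain ⟨e, he, h, hinv⟩ := G.exists_base_one
    obtain ⟨b, hb, hab⟩ := hinv (fun i => ⟨a.1 i, ha i⟩) ((realize_coe M G.dom _).1 a.2)
    let b' : G.Star := ⟨fun i => (b i : C), (realize_coe M G.dom b).2 hb⟩
    have h2 : b' * a = 1 := by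
      rw [← h]
      exact (G.mul_realize_iff _ _ _).1 ((mul_realize_coe M G.mul b _ e).2 hab)
    intro i
    rw [← eq_inv_of_mul_eq_one_left h2]
    exact (b i).2

/-! ### Type-definable sets and the logic topology -/

/-- `D ⊆ G*` is type-definable over `M`: an intersection of (relatively) `M`-definable sets. -/
def IsTypeDefinable (D : Set G.Star) : Prop :=
  ∃ 𝒮 : Set (Set (Fin n → C)), (∀ S ∈ 𝒮, (M : Set C).Definable L S) ∧
    D = {a | ∀ S ∈ 𝒮, a.1 ∈ S}

/-- A binary relation on `G*` is type-definable over `M`. -/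
def IsTypeDefinableRel (R : G.Star → G.Star → Prop) : Prop :=
  ∃ 𝒮 : Set (Set (Fin n ⊕ Fin n → C)), (∀ S ∈ 𝒮, (M : Set C).Definable L S) ∧
    ∀ a b : G.Star, R a b ↔ ∀ S ∈ 𝒮, Sum.elim a.1 b.1 ∈ S

/-- The topology on `G*` whose closed sets are the sets type-definable over `M`. -/
@[reducible]
def typeDefinableTopology : TopologicalSpace G.Star :=
  TopologicalSpace.ofClosed {D | G.IsTypeDefinable D}
    ⟨{∅}, by simp, by ext; simp⟩
    (by
      intro A hA
      have hA' : ∀ D : Set G.Star, ∃ 𝒮 : Set (Set (Fin n → C)), D ∈ A →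
          (∀ S ∈ 𝒮, (M : Set C).Definable L S) ∧ D = {a | ∀ S ∈ 𝒮, a.1 ∈ S} := by
        intro D
        by_cases h : D ∈ A
        · exact (hA h).imp fun _ h _ => h
        · exact ⟨∅, fun h' => absurd h' h⟩
      choose 𝒮 h𝒮 using hA'
      refine ⟨⋃ D ∈ A, 𝒮 D, ?_, ?_⟩
      · simp only [Set.mem_iUnion]
        rintro S ⟨D, hDA, hS⟩
        exact (h𝒮 D hDA).1 S hS
      · ext a
        simp only [Set.mem_sInter, Set.mem_iUnion, Set.mem_ofPred_eq]
        constructor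
        · rintro h S ⟨D, hDA, hS⟩
          have := h D hDA
          rw [(h𝒮 D hDA).2] at this
          exact this S hS
        · intro h D hDA
          rw [(h𝒮 D hDA).2]
          exact fun S hS => h S ⟨D, hDA, hS⟩)
    (by
      rintro D₁ ⟨𝒮₁, h₁, rfl⟩ D₂ ⟨𝒮₂, h₂, rfl⟩
      refine ⟨Set.image2 (· ∪ ·) 𝒮₁ 𝒮₂, ?_, ?_⟩
      · rintro _ ⟨S₁, hS₁, S₂, hS₂, rfl⟩
        exact (h₁ S₁ hS₁).union (h₂ S₂ hS₂)
      · ext a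
        simp only [Set.mem_union, Set.mem_ofPred_eq, Set.forall_mem_image2]
        constructor
        · rintro (h | h) S₁ hS₁ S₂ hS₂
          · exact Or.inl (h S₁ hS₁)
          · exact Or.inr (h S₂ hS₂)
        · intro h
          by_contra! hc
          obtain ⟨⟨S₁, hS₁, h1⟩, ⟨S₂, hS₂, h2⟩⟩ := hc
          exact (h S₁ hS₁ S₂ hS₂).elim h1 h2)

/-- The logic topology on the quotient `G*/E`: a set is closed iff its preimage in `G*` is
type-definable over `M`. -/
@[reducible]
def logicTopology (E : Setoid G.Star) : TopologicalSpace (Quotient E) :=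
  TopologicalSpace.coinduced (Quotient.mk E) G.typeDefinableTopology

theorem isClosed_logicTopology_iff (E : Setoid G.Star) (D : Set (Quotient E)) :
    @IsClosed _ (G.logicTopology E) D ↔ G.IsTypeDefinable (Quotient.mk E ⁻¹' D) := by
  let _ := G.typeDefinableTopology
  let _ := G.logicTopology E
  have h : IsClosed D ↔ IsClosed (Quotient.mk E ⁻¹' D) := isClosed_coinduced
  refine h.trans ?_
  rw [← isOpen_compl_iff]
  change (_ᶜᶜ : Set G.Star) ∈ {D | G.IsTypeDefinable D} ↔ _
  rw [compl_compl]
  rfl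

/-! ### `Δ`-definable sets and `Δ`-types

The set `Δ` of formulas `δ(x; y, z, t) = ψ(y · x · z; t)` is given by the set of the formulas
`ψ(x; t)`, where `x` is an `n`-tuple and `t` is a finite tuple of parametric variables. -/

variable (Δ : Set (Σ m : ℕ, L.Formula (Fin n ⊕ Fin m)))

/-- The subsets of `G*` defined by instances of formulas from `Δ` with parameters from `A`. -/
def instances (A : Set C) : Set (Set G.Star) :=
  {X | ∃ ψ ∈ Δ, ∃ (y z : G.Star) (p : Fin ψ.1 → C),
    (∀ i, y.1 i ∈ A) ∧ (∀ i, z.1 i ∈ A) ∧ (∀ i, p i ∈ A) ∧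
    X = {x | ψ.2.Realize (Sum.elim (y * x * z).1 p)}}

/-- The Boolean algebra of subsets of `G*` defined by Boolean combinations of instances of formulas
from `Δ` with parameters from `A`. For `A = M` these are the subsets of `G*` which are
`Δ`-definable over `M`; for general `A`, the subsets which are `Δ`-definable over `A` are by
convention the members of `deltaAlg Δ (dcl L A)`. -/
def deltaAlg (A : Set C) : BooleanSubalgebra (Set G.Star) :=
  BooleanSubalgebra.closure (G.instances Δ A)

/-- `S_{G,Δ}(M)`: complete `Δ`-types over `M` concentrating on `G`, that is, ultrafilters in the
Boolean algebra of (relatively) `Δ`-definable over `M` sets. -/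
structure TypeSpace where
  sets : Set (Set G.Star)
  sets_subset : ∀ X ∈ sets, X ∈ G.deltaAlg Δ M
  univ_mem : Set.univ ∈ sets
  inter_mem : ∀ X ∈ sets, ∀ Y ∈ sets, X ∩ Y ∈ sets
  superset_mem : ∀ X ∈ sets, ∀ Y ∈ G.deltaAlg Δ M, X ⊆ Y → Y ∈ sets
  compl_mem_iff : ∀ X ∈ G.deltaAlg Δ M, Xᶜ ∈ sets ↔ X ∉ sets

/-- The Stone topology on `S_{G,Δ}(M)`. -/
instance : TopologicalSpace (G.TypeSpace Δ) :=
  TopologicalSpace.generateFrom {U | ∃ X ∈ G.deltaAlg Δ M, U = {p | X ∈ p.sets}}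

/-- `tp_Δ(a/M)`. -/
def tp (a : G.Star) : G.TypeSpace Δ where
  sets := {X | X ∈ G.deltaAlg Δ M ∧ a ∈ X}
  sets_subset _ hX := hX.1
  univ_mem := ⟨BooleanSubalgebra.top_mem, trivial⟩
  inter_mem _ hX _ hY := ⟨BooleanSubalgebra.inf_mem hX.1 hY.1, hX.2, hY.2⟩
  superset_mem _ hX _ hY h := ⟨hY, h hX.2⟩
  compl_mem_iff _ hX :=
    ⟨fun h h' => h.2 h'.2, fun h => ⟨BooleanSubalgebra.compl_mem hX, fun h' => h ⟨hX, h'⟩⟩⟩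

/-- `tp_Δ(a/M, b)` is finitely satisfiable in `M`. -/
def IsCoheir (a b : G.Star) : Prop :=
  ∀ X ∈ G.deltaAlg Δ (dcl L ((M : Set C) ∪ Set.range b.1)), a ∈ X → ∃ g ∈ G.base, g ∈ X

/-! ### The relations `F₀`, `F`, `F̄` -/

/-- The relation `F₀` attached to `Δ`. -/
def F₀ (α β : G.Star) : Prop :=
  ∃ a b a₁ b₁ : G.Star, α = a * b ∧ β = a₁ * b₁ ∧
    G.tp Δ a = G.tp Δ a₁ ∧ G.tp Δ b = G.tp Δ b₁ ∧ G.IsCoheir Δ a b ∧ G.IsCoheir Δ a₁ b₁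

/-- The transitive closure of `F₀`. -/
def F : G.Star → G.Star → Prop := Relation.TransGen (G.F₀ Δ)

/-- The equivalence relations on `G*` which are type-definable over `M` and contain `F`. -/
def typeDefinableAbove : Set (Setoid G.Star) :=
  {R | G.IsTypeDefinableRel R ∧ ∀ a b, G.F Δ a b → R a b}

/-- `F̄`, the finest equivalence relation on `G*` which is type-definable over `M` and
contains `F`. -/
def FBar : Setoid G.Star := sInf (G.typeDefinableAbove Δ)

theorem isLeast_FBar : IsLeast (G.typeDefinableAbove Δ) (G.FBar Δ) := by
  refine ⟨⟨?_, fun a b h R hR => hR.2 a b h⟩, fun R hR => sInf_le hR⟩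
  have h : ∀ R ∈ G.typeDefinableAbove Δ, G.IsTypeDefinableRel R := fun R hR => hR.1
  choose! 𝒮 h𝒮 hR using h
  refine ⟨⋃ R ∈ G.typeDefinableAbove Δ, 𝒮 R, ?_, fun a b => ?_⟩
  · simp only [Set.mem_iUnion]
    rintro S ⟨R, hRA, hS⟩
    exact h𝒮 R hRA S hS
  · simp only [Set.mem_iUnion]
    constructor
    · rintro h S ⟨R, hRA, hS⟩
      exact (hR R hRA a b).1 (h R hRA) S hS
    · intro h R hRA
      exact (hR R hRA a b).2 fun S hS => h S ⟨R, hRA, hS⟩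

/-! ### `Δ`-definable maps, flows and ambits -/

/-- A map `f : G → X` into a topological space is `Δ`-definable: the preimages of disjoint closed
sets can be separated by a subset of `G` which is `Δ`-definable over `M`. -/
def IsDeltaDefinable {X : Type*} [TopologicalSpace X] (f : G.base → X) : Prop :=
  ∀ C₁ C₂ : Set X, IsClosed C₁ → IsClosed C₂ → Disjoint C₁ C₂ →
    ∃ D ∈ G.deltaAlg Δ M, ∀ g : G.base,
      (f g ∈ C₁ → (g : G.Star) ∈ D) ∧ (f g ∈ C₂ → (g : G.Star) ∉ D)

/-- A map `f : G* → X` is `Δ`-definable over `M`: the preimage of every closed set is an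
intersection of sets which are `Δ`-definable over `M`. -/
def IsDeltaDefinableStar {X : Type*} [TopologicalSpace X] (f : G.Star → X) : Prop :=
  ∀ C₁ : Set X, IsClosed C₁ → ∃ 𝒮 : Set (Set G.Star),
    (∀ S ∈ 𝒮, S ∈ G.deltaAlg Δ M) ∧ f ⁻¹' C₁ = ⋂₀ 𝒮

/-- `(G, X, x₀)` is a `Δ`-definable `G`-ambit: `G` acts on the compact Hausdorff space `X` by
homeomorphisms, the orbit of `x₀` is dense, and all the maps `g ↦ g • x` are `Δ`-definable. -/
structure IsDeltaAmbit (X : Type*) [TopologicalSpace X] [MulAction G.base X] (x₀ : X) :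
    Prop where
  compactSpace : CompactSpace X
  t2Space : T2Space X
  continuous_smul : ∀ g : G.base, Continuous fun x : X => g • x
  dense_orbit : Dense (MulAction.orbit G.base x₀)
  definable : ∀ x : X, G.IsDeltaDefinable Δ fun g => g • x

/-- `(G, X, x₀)` is a universal `Δ`-definable `G`-ambit (with respect to all ambits with underlying
space in `Type t`). -/
structure IsUniversalDeltaAmbit (X : Type s) [TopologicalSpace X] [MulAction G.base X]
    (x₀ : X) : Prop extends G.IsDeltaAmbit Δ X x₀ where
  exists_unique_hom : ∀ (Y : Type t) [TopologicalSpace Y] [MulAction G.base Y] (y₀ : Y),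
    G.IsDeltaAmbit Δ Y y₀ →
    ∃! h : X → Y, Continuous h ∧ (∀ (g : G.base) (x : X), h (g • x) = g • h x) ∧ h x₀ = y₀

/-! ### The relations `E` and `E'` -/

/-- `fStar : G* → U` is the prolongation of `f : G → U`. -/
def IsProlongation {U : Type*} [TopologicalSpace U] (f : G.base → U) (fStar : G.Star → U) :
    Prop :=
  G.IsDeltaDefinableStar Δ fStar ∧ ∀ g : G.base, fStar g = f g

/-- The relation `E` on `S_{G,Δ}(M)` induced by the ambit `(G, U, x)`: `E(p, q)` iff `h(p) = h(q)`
for the continuous `h : S_{G,Δ}(M) → U` such that `a ↦ h(tp_Δ(a/M))` is the prolongation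
of `g ↦ g • x`. (Such an `h` is unique; as `h` is bound by an existential quantifier,
reflexivity of `E` asserts that it exists.) -/
def E (U : Type*) [TopologicalSpace U] [MulAction G.base U] (x : U) (p q : G.TypeSpace Δ) : Prop :=
  ∃ h : G.TypeSpace Δ → U, Continuous h ∧
    G.IsProlongation Δ (fun g => g • x) (fun a => h (G.tp Δ a)) ∧ h p = h q

/-- The relation `E'` on `G*` induced by the ambit `(G, U, x)`. -/
def E' (U : Type*) [TopologicalSpace U] [MulAction G.base U] (x : U) (a b : G.Star) : Prop :=
  G.E Δ U x (G.tp Δ a) (G.tp Δ b)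

end DefinableGroup

end DeltaFlow

namespace DeltaFlow

open Set Filter Topology

variable {L : FirstOrder.Language.{u, v}} {C : Type w} [L.Structure C]

/-! ### Definable closure and saturation -/

/-! Give `G*` the topology whose closed sets are the sets type-definable over `M`. Saturation makes
it compact, and Tarski–Vaught makes `G` dense. Then `tp` is a quotient map from `G*` onto the
compact Hausdorff Stone space `S`, and maps out of `S` are controlled by their values on `G`.

The quotient by `FBar` is an ambit. Taking `b = 1` in `F₀` shows that elements with the same type
are equivalent, so the quotient is also a quotient of `S`. It is Hausdorff because the image of
`FBar` in `S × S` is closed (`isClosed_image_rel`). Orbit maps are `Δ`-definable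
(`isDeltaDefinable_smul`) because the class of `a * b` depends only on the types of `a` and `b` once
`a` is a coheir over `b`. This is exactly what `F₀` forces.

It is universal. For an ambit `Y`, the orbit map of the base point extends to a continuous `F` on
`S` (`IsDeltaDefinable.exists_extension`). If `a` is a coheir over `b`, then `F` at `a * b` is
computed from the type of `a` by the extension of the orbit map of the point `F (tp b)`
(`extension_mul_of_isCoheir`). Hence the kernel of `F ∘ tp` is a type-definable equivalence relation
containing `F₀`, so it contains `FBar`, and `F` descends to the quotient. Uniqueness follows from
density of the orbit.

Applied to a universal ambit `U`, this gives one inclusion between `FBar` and `E'`. The other holds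
because the map from `U` to the quotient, composed with `h`, agrees with the projection on the dense
set of types of elements of `G`, hence everywhere. -/

theorem definableFun_const_of_mem_dcl {A : Set C} {c : C} (hc : c ∈ dcl L A) (α : Type*) :
    A.DefinableFun L (fun _ : α → C => c) := by
  have h : A.Definable L {x : Fin 1 → C | x 0 ∈ ({c} : Set C)} := hc
  refine (congr rfl (Set.ext fun w => ?_)).mp (h.preimage_comp (fun _ : Fin 1 => (none : Option α)))
  simp [Function.tupleGraph, eq_comm]

theorem subset_dcl (A : Set C) : A ⊆ dcl L A :=
  fun _ h => Definable.singleton_of_mem L h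

/-- Parameters from the definable closure of `A` can be replaced by parameters from `A`. -/
theorem definable_of_dcl {A : Set C} {α : Type*} [Finite α] {S : Set (α → C)}
    (h : (dcl L A).Definable L S) : A.Definable L S := by
  -- Only finitely many parameters occur. They become variables of a parameter-free formula, into
  -- which the `A`-definable constant maps are substituted.
  obtain ⟨A₀, hA₀, h⟩ := definable_iff_finitely_definable.1 h
  obtain ⟨φ, rfl⟩ := definable_iff_exists_formula_sum.1 h
  have hφ : A.Definable L {w : (A₀ : Set C) ⊕ α → C | φ.Realize w} :=
    (empty_definable_iff.2 ⟨φ, rfl⟩).mono (empty_subset A)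
  have hF : A.DefinableMap L
      (fun v : α → C => Sum.elim (fun c : (A₀ : Set C) => (c : C)) v) := by
    rintro (c | i)
    · exact definableFun_const_of_mem_dcl (hA₀ c.2) α
    · exact DefinableFun.proj L
  exact hφ.preimage_map hF

theorem dcl_dcl (A : Set C) : dcl L (dcl L A) = dcl L A :=
  Subset.antisymm (fun _ h => definable_of_dcl h) (subset_dcl _)

/-- Saturation, for filters on the finite powers of `C`. -/
theorem IsSaturated.exists_forall_mem {κ : Cardinal.{w}} (hC : IsSaturated L C κ) {A : Set C}
    (hA : Cardinal.mk A < κ) {α : Type*} [Finite α] (l : Filter (α → C)) [l.NeBot] :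
    ∃ x : α → C, ∀ S ∈ l, A.Definable L S → x ∈ S := by
  obtain ⟨m, ⟨e⟩⟩ := Finite.exists_equiv_fin α
  obtain ⟨x, hx⟩ := hC A hA m {φ | {y : α → C | φ.Realize (y ∘ e.symm)} ∈ l} (by
    intro Φ₀ hΦ₀
    obtain ⟨y, hy⟩ := l.nonempty_of_mem ((biInter_finset_mem Φ₀).2 hΦ₀)
    exact ⟨y ∘ e.symm, fun φ hφ => mem_iInter₂.1 hy φ hφ⟩)
  refine ⟨x ∘ e, fun S hS hdef => ?_⟩
  obtain ⟨φ, hφ⟩ := hdef.preimage_comp (fun i => e i)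
  have h : ∀ z : Fin m → C, φ.Realize z ↔ z ∘ e ∈ S := fun z => by
    rw [← mem_preimage (f := fun g : Fin m → C => g ∘ e)]
    exact (Set.ext_iff.1 hφ z).symm
  refine (h x).1 (hx φ ?_)
  have h' : {y : α → C | φ.Realize (y ∘ e.symm)} = S := by
    ext y
    simp [h, Function.comp_assoc]
  rw [mem_ofPred_eq, h']
  exact hS

namespace DefinableGroup

variable {M : L.ElementarySubstructure C} {n : ℕ} (G : DefinableGroup M n)

/-! ### Definable subsets of `G*` -/

/-- `X ⊆ G*` is (relatively) definable over `A`. -/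
def IsDefinableOver (A : Set C) (X : Set G.Star) : Prop :=
  ∃ S : Set (Fin n → C), A.Definable L S ∧ X = {a | a.1 ∈ S}

variable {G} {A : Set C} {X Y : Set G.Star}

theorem IsDefinableOver.compl (h : G.IsDefinableOver A X) : G.IsDefinableOver A Xᶜ := by
  obtain ⟨S, hS, rfl⟩ := h
  exact ⟨Sᶜ, hS.compl, rfl⟩

theorem IsDefinableOver.union (hX : G.IsDefinableOver A X) (hY : G.IsDefinableOver A Y) :
    G.IsDefinableOver A (X ∪ Y) := by
  obtain ⟨S, hS, rfl⟩ := hX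
  obtain ⟨T, hT, rfl⟩ := hY
  exact ⟨S ∪ T, hS.union hT, rfl⟩

theorem isDefinableOver_of_dcl (h : G.IsDefinableOver (dcl L A) X) : G.IsDefinableOver A X := by
  obtain ⟨S, hS, rfl⟩ := h
  exact ⟨S, definable_of_dcl hS, rfl⟩

theorem IsDefinableOver.mono {B : Set C} (h : G.IsDefinableOver A X) (hAB : A ⊆ B) :
    G.IsDefinableOver B X := by
  obtain ⟨S, hS, rfl⟩ := h
  exact ⟨S, hS.mono hAB, rfl⟩

variable (G)

theorem definable_dom : A.Definable L {x : Fin n → C | G.dom.Realize x} :=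
  (empty_definable_iff.2 ⟨G.dom, rfl⟩).mono (empty_subset A)

theorem definable_mul : A.Definable L {x : Fin n ⊕ (Fin n ⊕ Fin n) → C | G.mul.Realize x} :=
  (empty_definable_iff.2 ⟨G.mul, rfl⟩).mono (empty_subset A)

variable {G}

/-- Multiplication is given only by its graph, so the product enters as an existentially quantified
tuple. Requiring `dom` of this tuple makes it equal to the product. -/
theorem IsDefinableOver.mul_left (h : G.IsDefinableOver A X) {y : G.Star} (hy : ∀ i, y.1 i ∈ A) :
    G.IsDefinableOver A {x | y * x ∈ X} := by
  obtain ⟨S, hS, rfl⟩ := h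
  have hF : A.DefinableMap L (fun v : Fin n ⊕ Fin n → C => Sum.elim y.1 v) := by
    rintro (i | i)
    · exact definableFun_const _ _ (hy i)
    · exact DefinableFun.proj L
  refine ⟨_, (((G.definable_mul).preimage_map hF).inter
    ((G.definable_dom.inter hS).preimage_comp Sum.inr)).exists_of_finite, ?_⟩
  ext x
  constructor
  · intro hx
    refine ⟨(y * x).1, ?_, (y * x).2, hx⟩
    exact G.mul_realize y x
  · rintro ⟨u, h1, h2, h3⟩
    have : y * x = ⟨u, h2⟩ := (G.mul_realize_iff _ _ _).1 h1
    rw [mem_ofPred_eq, this]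
    exact h3

theorem IsDefinableOver.mul_right (h : G.IsDefinableOver A X) {z : G.Star}
    (hz : ∀ i, z.1 i ∈ A) : G.IsDefinableOver A {x | x * z ∈ X} := by
  obtain ⟨S, hS, rfl⟩ := h
  have hF : A.DefinableMap L (fun v : Fin n ⊕ Fin n → C =>
      Sum.elim (v ∘ Sum.inl) (Sum.elim z.1 (v ∘ Sum.inr))) := by
    rintro (i | i | i)
    · exact DefinableFun.proj L
    · exact definableFun_const _ _ (hz i)
    · exact DefinableFun.proj L
  refine ⟨_, (((G.definable_mul).preimage_map hF).inter
    ((G.definable_dom.inter hS).preimage_comp Sum.inr)).exists_of_finite, ?_⟩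
  ext x
  constructor
  · intro hx
    refine ⟨(x * z).1, ?_, (x * z).2, hx⟩
    exact G.mul_realize x z
  · rintro ⟨u, h1, h2, h3⟩
    have : x * z = ⟨u, h2⟩ := (G.mul_realize_iff _ _ _).1 h1
    rw [mem_ofPred_eq, this]
    exact h3

/-- The definable closure is closed under multiplication. -/
theorem mul_mem_dcl {y z : G.Star} (hy : ∀ i, y.1 i ∈ A) (hz : ∀ i, z.1 i ∈ A) (i : Fin n) :
    (y * z).1 i ∈ dcl L A := by
  have hF : A.DefinableMap L (fun v : Fin 1 ⊕ Fin n → C =>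
      Sum.elim y.1 (Sum.elim z.1 (v ∘ Sum.inr))) := by
    rintro (i | i | i)
    · exact definableFun_const _ _ (hy i)
    · exact definableFun_const _ _ (hz i)
    · exact DefinableFun.proj L
  have hE : A.Definable L {v : Fin 1 ⊕ Fin n → C | v (Sum.inr i) = v (Sum.inl 0)} :=
    (DefinableFun.proj L).ofPred_eq (DefinableFun.proj L)
  refine (congrArg (A.Definable L) (Set.ext fun v => ?_)).mp
    ((((G.definable_mul).preimage_map hF).inter
      (hE.inter (G.definable_dom.preimage_comp Sum.inr))).exists_of_finite)
  constructor
  · rintro ⟨u, h1, h2, h3⟩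
    have : y * z = ⟨u, h3⟩ := (G.mul_realize_iff _ _ _).1 h1
    rw [mem_ofPred_eq, this]
    exact h2.symm
  · intro h
    exact ⟨(y * z).1, G.mul_realize y z, h.symm, (y * z).2⟩

theorem mul_mem_dcl' {y z : G.Star} (hy : ∀ i, y.1 i ∈ dcl L A) (hz : ∀ i, z.1 i ∈ dcl L A)
    (i : Fin n) : (y * z).1 i ∈ dcl L A := by
  have := mul_mem_dcl hy hz i
  rwa [dcl_dcl] at this

/-- Left translation by an element of `A` preserves definability of relations over `A`. -/
theorem exists_definable_mul_left {S : Set (Fin n ⊕ Fin n → C)} (hS : A.Definable L S)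
    {y : G.Star} (hy : ∀ i, y.1 i ∈ A) :
    ∃ T : Set (Fin n ⊕ Fin n → C), A.Definable L T ∧
      ∀ a b : G.Star, Sum.elim a.1 b.1 ∈ T ↔ Sum.elim (y * a).1 (y * b).1 ∈ S := by
  let γ := (Fin n ⊕ Fin n) ⊕ (Fin n ⊕ Fin n)
  have hF (f : Fin n ⊕ Fin n → γ) : A.DefinableMap L (fun v : γ → C => Sum.elim y.1 (v ∘ f)) := by
    rintro (i | i)
    · exact definableFun_const _ _ (hy i)
    · exact DefinableFun.proj L
  refine ⟨_, ((((G.definable_mul).preimage_map (hF (Sum.map Sum.inl Sum.inl))).inter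
    ((G.definable_mul).preimage_map (hF (Sum.map Sum.inr Sum.inr)))).inter
    (((G.definable_dom.preimage_comp (Sum.inl : Fin n → Fin n ⊕ Fin n)).inter
      ((G.definable_dom.preimage_comp Sum.inr).inter hS)).preimage_comp
      Sum.inr)).exists_of_finite, fun a b => ?_⟩
  have key (a : G.Star) (u : Fin n → C) (x : Fin n ⊕ Fin n → C) (hx : x = Sum.elim a.1 u)
      (h : G.mul.Realize (Sum.elim y.1 x)) (hu : G.dom.Realize u) : u = (y * a).1 := by
    subst hx
    exact congrArg Subtype.val ((G.mul_realize_iff y a ⟨u, hu⟩).1 h).symm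
  constructor
  · rintro ⟨u, ⟨h1, h2⟩, h3, h4, h5⟩
    have e1 := key a (u ∘ Sum.inl) _ (by ext (i | i) <;> rfl) h1 h3
    have e2 := key b (u ∘ Sum.inr) _ (by ext (i | i) <;> rfl) h2 h4
    rw [← e1, ← e2, Sum.elim_comp_inl_inr]
    exact h5
  · intro h
    refine ⟨Sum.elim (y * a).1 (y * b).1, ⟨?_, ?_⟩, (y * a).2, (y * b).2, h⟩
    · refine (congrArg G.mul.Realize ?_).mp (G.mul_realize y a)
      ext (i | i | i) <;> rfl
    · refine (congrArg G.mul.Realize ?_).mp (G.mul_realize y b)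
      ext (i | i | i) <;> rfl

/-- Tarski–Vaught: nonempty subsets of `G*` definable over `M` meet `G`. -/
theorem IsDefinableOver.exists_mem_base (h : G.IsDefinableOver (M : Set C) X)
    (hX : X.Nonempty) : ∃ g ∈ G.base, g ∈ X := by
  obtain ⟨S, hS, rfl⟩ := h
  obtain ⟨a, ha⟩ := hX
  obtain ⟨φ, rfl⟩ := definable_iff_exists_formula_sum.1 hS
  -- The parameters are kept as free variables indexed by `M`, so elementarity applies directly. The
  -- conjunct `dom` puts the witness in `G`.
  let ψ : L.Formula (M ⊕ Fin n) := φ ⊓ G.dom.relabel Sum.inr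
  have hψ : (ψ.iExs (Fin n)).Realize (fun c : M => (c : C)) := by
    rw [Formula.realize_iExs]
    refine ⟨a.1, Formula.realize_inf.2 ⟨ha, ?_⟩⟩
    rw [Formula.realize_relabel]
    exact a.2
  obtain ⟨x, hx⟩ := Formula.realize_iExs.1 ((realize_coe M (ψ.iExs (Fin n)) id).1 hψ)
  have hx' := (realize_coe M ψ _).2 hx
  have e : (fun i => ((Sum.elim (id : M → M) x i : M) : C)) =
      Sum.elim (fun c : M => (c : C)) (fun i => (x i : C)) := by
    ext (i | i) <;> rfl
  rw [e, Formula.realize_inf, Formula.realize_relabel] at hx'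
  exact ⟨⟨fun i => (x i : C), hx'.2⟩, fun i => (x i).2, hx'.1⟩

/-- Saturation, for filters on `G*`. -/
theorem exists_forall_mem {κ : Cardinal.{w}} (hC : IsSaturated L C κ)
    (hA : Cardinal.mk A < κ) (l : Filter G.Star) [l.NeBot] :
    ∃ a : G.Star, ∀ X ∈ l, G.IsDefinableOver A X → a ∈ X := by
  obtain ⟨x, hx⟩ := hC.exists_forall_mem hA (l.map fun a : G.Star => a.1)
  refine ⟨⟨x, hx _ ?_ G.definable_dom⟩, ?_⟩
  · exact Filter.mem_map.2 (mem_of_superset univ_mem fun (a : G.Star) _ => a.2)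
  · rintro _ hX ⟨S, hS, rfl⟩
    exact hx S hX hS

/-! ### `G*` as a compact space -/

attribute [local instance] typeDefinableTopology

theorem isClosed_iff_isTypeDefinable {D : Set G.Star} : IsClosed D ↔ G.IsTypeDefinable D := by
  rw [← isOpen_compl_iff]
  change (_ᶜᶜ : Set G.Star) ∈ {D | G.IsTypeDefinable D} ↔ _
  rw [compl_compl]
  rfl

theorem IsDefinableOver.isClosed (h : G.IsDefinableOver (M : Set C) X) : IsClosed X := by
  obtain ⟨S, hS, rfl⟩ := h
  exact isClosed_iff_isTypeDefinable.2 ⟨{S}, by simpa using hS, by simp⟩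

theorem IsDefinableOver.isClopen (h : G.IsDefinableOver (M : Set C) X) : IsClopen X :=
  ⟨h.isClosed, isClosed_compl_iff.1 h.compl.isClosed⟩

/-- Reduces membership in a closed set to one definable superset at a time, the form in which
saturation and Tarski–Vaught apply. -/
theorem mem_closed_iff {D : Set G.Star} (hD : IsClosed D) {a : G.Star} :
    a ∈ D ↔ ∀ X, G.IsDefinableOver (M : Set C) X → D ⊆ X → a ∈ X := by
  refine ⟨fun h X _ hX => hX h, fun h => ?_⟩
  obtain ⟨𝒮, h𝒮, rfl⟩ := isClosed_iff_isTypeDefinable.1 hD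
  exact fun S hS => h {a | a.1 ∈ S} ⟨S, h𝒮 S hS, rfl⟩ (fun a ha => ha S hS)

/-- Saturation gives a point in every `M`-definable member of the filter. It lies in the closure of
each member, so it is a cluster point. -/
theorem compactSpace_star {κ : Cardinal.{w}} (hM : Cardinal.mk M < κ)
    (hC : IsSaturated L C κ) : CompactSpace G.Star := by
  refine ⟨fun l _ _ => ?_⟩
  obtain ⟨a, ha⟩ := exists_forall_mem (A := (M : Set C)) hC hM l
  refine ⟨a, mem_univ a, clusterPt_iff_forall_mem_closure.2 fun s hs => ?_⟩
  exact (mem_closed_iff isClosed_closure).2 fun X hX h =>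
    ha X (mem_of_superset hs (subset_closure.trans h)) hX

theorem dense_base : Dense (G.base : Set G.Star) := by
  intro a
  refine (mem_closed_iff isClosed_closure).2 fun X hX h => ?_
  by_contra ha
  obtain ⟨g, hg, hgX⟩ := hX.compl.exists_mem_base ⟨a, ha⟩
  exact hgX (h (subset_closure hg))

theorem continuous_mul_left (g : G.base) : Continuous fun a : G.Star => (g : G.Star) * a := by
  refine continuous_iff_isClosed.2 fun D hD => ?_
  have : (fun a : G.Star => (g : G.Star) * a) ⁻¹' D =
      ⋂ X ∈ {X | G.IsDefinableOver (M : Set C) X ∧ D ⊆ X}, {a | (g : G.Star) * a ∈ X} := by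
    ext a
    simp only [mem_preimage, mem_iInter₂, mem_closed_iff hD, mem_ofPred_eq, and_imp]
  rw [this]
  exact isClosed_biInter fun X hX => (hX.1.mul_left (y := (g : G.Star)) g.2).isClosed

variable {Δ : Set (Σ m : ℕ, L.Formula (Fin n ⊕ Fin m))} {B : Set C}

/-! ### `Δ`-definable sets -/

theorem isDefinableOver_of_mem_deltaAlg (h : X ∈ G.deltaAlg Δ A) : G.IsDefinableOver A X := by
  refine BooleanSubalgebra.closure_bot_sup_induction (p := fun X _ => G.IsDefinableOver A X)
    ?_ ⟨∅, definable_empty, rfl⟩ (fun _ _ _ _ hX hY => hX.union hY) (fun _ _ hX => hX.compl) h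
  rintro _ ⟨ψ, -, y, z, p, hy, hz, hp, rfl⟩
  have hF : A.DefinableMap L (fun v : Fin n → C => Sum.elim v p) := by
    rintro (i | i)
    · exact DefinableFun.proj L
    · exact definableFun_const _ _ (hp i)
  have h : G.IsDefinableOver A {x : G.Star | ψ.2.Realize (Sum.elim x.1 p)} :=
    ⟨_, (((empty_definable_iff (L := L)).2 ⟨ψ.2, rfl⟩).mono (empty_subset A)).preimage_map hF, rfl⟩
  simpa only [mul_assoc, mem_ofPred_eq] using (h.mul_right hz).mul_left hy

theorem preimage_mem_deltaAlg {f : G.Star → G.Star}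
    (hf : ∀ X ∈ G.instances Δ A, f ⁻¹' X ∈ G.instances Δ B) (h : X ∈ G.deltaAlg Δ A) :
    f ⁻¹' X ∈ G.deltaAlg Δ B :=
  BooleanSubalgebra.closure_bot_sup_induction (p := fun X _ => f ⁻¹' X ∈ G.deltaAlg Δ B)
    (fun X hX => BooleanSubalgebra.subset_closure (hf X hX)) BooleanSubalgebra.bot_mem
    (fun _ _ _ _ hX hY => BooleanSubalgebra.sup_mem hX hY)
    (fun _ _ hX => BooleanSubalgebra.compl_mem hX) h

/-- The shape of the formulas in `Δ` is used here: `g` is absorbed into the left parameter. The new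
parameter `y * g` has coordinates only in the definable closure, whence `dcl`. -/
theorem deltaAlg_mul_left {g : G.Star} (hg : ∀ i, g.1 i ∈ dcl L A)
    (h : X ∈ G.deltaAlg Δ (dcl L A)) : (fun x => g * x) ⁻¹' X ∈ G.deltaAlg Δ (dcl L A) := by
  refine preimage_mem_deltaAlg ?_ h
  rintro _ ⟨ψ, hψ, y, z, p, hy, hz, hp, rfl⟩
  refine ⟨ψ, hψ, y * g, z, p, mul_mem_dcl' hy hg, hz, hp, ?_⟩
  simp only [preimage_ofPred_eq, mul_assoc]

theorem deltaAlg_mul_left_base (g : G.base) (h : X ∈ G.deltaAlg Δ M) :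
    (fun x => (g : G.Star) * x) ⁻¹' X ∈ G.deltaAlg Δ M := by
  refine preimage_mem_deltaAlg ?_ h
  rintro _ ⟨ψ, hψ, y, z, p, hy, hz, hp, rfl⟩
  refine ⟨ψ, hψ, y * g, z, p, G.base.mul_mem (x := y) hy g.2, hz, hp, ?_⟩
  simp only [preimage_ofPred_eq, mul_assoc]

/-- This is why coheirs are tested on sets over `dcl` of `M` and `b`: the right parameter becomes `b
* z`. -/
theorem deltaAlg_mul_right (b : G.Star) (h : X ∈ G.deltaAlg Δ M) :
    (fun x => x * b) ⁻¹' X ∈ G.deltaAlg Δ (dcl L ((M : Set C) ∪ range b.1)) := by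
  refine preimage_mem_deltaAlg ?_ h
  rintro _ ⟨ψ, hψ, y, z, p, hy, hz, hp, rfl⟩
  refine ⟨ψ, hψ, y, b * z, p, fun i => subset_dcl _ (Or.inl (hy i)),
    mul_mem_dcl (fun i => Or.inr ⟨i, rfl⟩) (fun i => Or.inl (hz i)),
    fun i => subset_dcl _ (Or.inl (hp i)), ?_⟩
  simp only [preimage_ofPred_eq, mul_assoc]

theorem deltaAlg_mono (hAB : A ⊆ B) : G.deltaAlg Δ A ≤ G.deltaAlg Δ B := by
  refine BooleanSubalgebra.closure_mono ?_
  rintro _ ⟨ψ, hψ, y, z, p, hy, hz, hp, rfl⟩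
  exact ⟨ψ, hψ, y, z, p, fun i => hAB (hy i), fun i => hAB (hz i), fun i => hAB (hp i), rfl⟩

/-! ### The Stone space -/

namespace TypeSpace

theorem ext_sets {p q : G.TypeSpace Δ} (h : p.sets = q.sets) : p = q := by
  cases p
  cases q
  congr

theorem ext_of_subset {p q : G.TypeSpace Δ} (h : p.sets ⊆ q.sets) : p = q := by
  refine ext_sets (h.antisymm fun X hX => ?_)
  by_contra hc
  exact (q.compl_mem_iff X (q.sets_subset X hX)).1
    (h ((p.compl_mem_iff X (q.sets_subset X hX)).2 hc)) hX

theorem nonempty_of_mem (p : G.TypeSpace Δ) (hX : X ∈ p.sets) : X.Nonempty := by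
  by_contra h
  rw [not_nonempty_iff_eq_empty] at h
  subst h
  exact (p.compl_mem_iff ∅ (p.sets_subset _ hX)).1 (by simpa using p.univ_mem) hX

theorem isOpen_setOf_mem (hX : X ∈ G.deltaAlg Δ M) : IsOpen {p : G.TypeSpace Δ | X ∈ p.sets} :=
  TopologicalSpace.isOpen_generateFrom_of_mem ⟨X, hX, rfl⟩

theorem setOf_mem_compl (hX : X ∈ G.deltaAlg Δ M) :
    {p : G.TypeSpace Δ | X ∈ p.sets}ᶜ = {p | Xᶜ ∈ p.sets} := by
  ext p
  exact (p.compl_mem_iff X hX).symm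

theorem isClopen_setOf_mem (hX : X ∈ G.deltaAlg Δ M) :
    IsClopen {p : G.TypeSpace Δ | X ∈ p.sets} := by
  refine ⟨⟨?_⟩, isOpen_setOf_mem hX⟩
  rw [setOf_mem_compl hX]
  exact isOpen_setOf_mem (BooleanSubalgebra.compl_mem hX)

theorem isTopologicalBasis : TopologicalSpace.IsTopologicalBasis
    {U | ∃ X ∈ G.deltaAlg Δ M, U = {p : G.TypeSpace Δ | X ∈ p.sets}} where
  exists_subset_inter := by
    rintro _ ⟨X, hX, rfl⟩ _ ⟨Y, hY, rfl⟩ p ⟨hp₁, hp₂⟩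
    exact ⟨_, ⟨X ∩ Y, BooleanSubalgebra.inf_mem hX hY, rfl⟩, p.inter_mem X hp₁ Y hp₂,
      fun q hq => ⟨q.superset_mem _ hq X hX inter_subset_left,
        q.superset_mem _ hq Y hY inter_subset_right⟩⟩
  sUnion_eq := eq_univ_of_forall fun p =>
    ⟨_, ⟨univ, BooleanSubalgebra.top_mem, rfl⟩, p.univ_mem⟩
  eq_generateFrom := rfl

theorem mem_nhds_iff {p : G.TypeSpace Δ} {U : Set (G.TypeSpace Δ)} :
    U ∈ 𝓝 p ↔ ∃ X ∈ p.sets, {q : G.TypeSpace Δ | X ∈ q.sets} ⊆ U := by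
  rw [isTopologicalBasis.mem_nhds_iff]
  constructor
  · rintro ⟨_, ⟨X, hX, rfl⟩, hp, h⟩
    exact ⟨X, hp, h⟩
  · rintro ⟨X, hp, h⟩
    exact ⟨_, ⟨X, p.sets_subset X hp, rfl⟩, hp, h⟩

instance : T2Space (G.TypeSpace Δ) where
  t2 p q hpq := by
    obtain ⟨X, hp, hq⟩ := not_subset.1 fun h => hpq (ext_of_subset h)
    have hX := p.sets_subset X hp
    exact ⟨_, _, isOpen_setOf_mem hX, (isClopen_setOf_mem hX).compl.isOpen, hp, hq,
      disjoint_compl_right⟩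

end TypeSpace

theorem mem_tp_sets {a : G.Star} (hX : X ∈ G.deltaAlg Δ M) : X ∈ (G.tp Δ a).sets ↔ a ∈ X :=
  ⟨fun h => h.2, fun h => ⟨hX, h⟩⟩

theorem tp_eq_tp_iff {a b : G.Star} :
    G.tp Δ a = G.tp Δ b ↔ ∀ X ∈ G.deltaAlg Δ M, a ∈ X → b ∈ X :=
  ⟨fun h _ hX ha => (mem_tp_sets hX).1 (h ▸ (mem_tp_sets hX).2 ha),
    fun h => TypeSpace.ext_of_subset fun X hX => ⟨hX.1, h X hX.1 hX.2⟩⟩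

theorem continuous_tp : Continuous (G.tp Δ) := by
  refine continuous_generateFrom_iff.2 ?_
  rintro _ ⟨X, hX, rfl⟩
  have : G.tp Δ ⁻¹' {p | X ∈ p.sets} = X := Set.ext fun a => mem_tp_sets hX
  rw [this]
  exact (isDefinableOver_of_mem_deltaAlg hX).isClopen.isOpen

theorem tp_eq_of_forall {p : G.TypeSpace Δ} {a : G.Star} (h : ∀ X ∈ p.sets, a ∈ X) :
    G.tp Δ a = p :=
  (TypeSpace.ext_of_subset fun X hX =>
    (mem_tp_sets (p.sets_subset X hX)).2 (h X hX)).symm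

theorem preimage_mem_comap_nhds {p : G.TypeSpace Δ} (hX : X ∈ p.sets) :
    X ∈ comap (G.tp Δ) (𝓝 p) :=
  ⟨_, TypeSpace.mem_nhds_iff.2 ⟨X, hX, Subset.rfl⟩, fun _ h => h.2⟩

/-! ### Realizing types, and closed relations on the type space. -/

section Saturated

variable {κ : Cardinal.{w}}

theorem surjective_tp (hM : Cardinal.mk M < κ) (hC : IsSaturated L C κ) :
    Function.Surjective (G.tp Δ) := by
  intro p
  have : (comap (G.tp Δ) (𝓝 p)).NeBot := by
    refine comap_neBot fun U hU => ?_
    obtain ⟨X, hX, h⟩ := TypeSpace.mem_nhds_iff.1 hU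
    obtain ⟨a, ha⟩ := p.nonempty_of_mem hX
    exact ⟨a, h ((mem_tp_sets (p.sets_subset X hX)).2 ha)⟩
  obtain ⟨a, ha⟩ := exists_forall_mem (A := (M : Set C)) hC hM (comap (G.tp Δ) (𝓝 p))
  exact ⟨a, tp_eq_of_forall fun X hX => ha X (preimage_mem_comap_nhds hX)
    (isDefinableOver_of_mem_deltaAlg (p.sets_subset X hX))⟩

theorem compactSpace_typeSpace (hM : Cardinal.mk M < κ) (hC : IsSaturated L C κ) :
    CompactSpace (G.TypeSpace Δ) :=
  have := compactSpace_star (G := G) hM hC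
  (surjective_tp hM hC).compactSpace continuous_tp

theorem isQuotientMap_tp (hM : Cardinal.mk M < κ) (hC : IsSaturated L C κ) :
    IsQuotientMap (G.tp Δ) :=
  have := compactSpace_star (G := G) hM hC
  continuous_tp.isClosedMap.isQuotientMap continuous_tp (surjective_tp hM hC)

/-- The image in `S × S` of a type-definable relation is closed. -/
theorem isClosed_image_rel (hM : Cardinal.mk M < κ) (hC : IsSaturated L C κ)
    {R : G.Star → G.Star → Prop} (hR : G.IsTypeDefinableRel R) :
    IsClosed (Prod.map (G.tp Δ) (G.tp Δ) '' {x | R x.1 x.2}) := by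
  obtain ⟨𝒮, h𝒮, hR⟩ := hR
  refine isClosed_of_closure_subset ?_
  rintro ⟨p, q⟩ hpq
  -- A type-definable relation need not be closed in the product topology on `G* × G*`, so
  -- saturation is applied to `2n`-tuples instead of using compactness of the product.
  let l : Filter (G.Star × G.Star) :=
    comap (Prod.map (G.tp Δ) (G.tp Δ)) (𝓝 (p, q)) ⊓ 𝓟 {x | R x.1 x.2}
  have hl : l.NeBot := by
    rw [← map_neBot_iff (Prod.map (G.tp Δ) (G.tp Δ)), Filter.push_pull', map_principal]
    exact mem_closure_iff_clusterPt.1 hpq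
  obtain ⟨x, hx⟩ := hC.exists_forall_mem (A := (M : Set C)) hM
    (l.map fun y => Sum.elim y.1.1 y.2.1)
  have hx' (S : Set (Fin n ⊕ Fin n → C)) (hS : (M : Set C).Definable L S)
      (h : (fun y : G.Star × G.Star => Sum.elim y.1.1 y.2.1) ⁻¹' S ∈ l) : x ∈ S := hx S h hS
  have hd₁ := hx' _ (G.definable_dom.preimage_comp Sum.inl)
    (mem_of_superset univ_mem fun y _ => y.1.2)
  have hd₂ := hx' _ (G.definable_dom.preimage_comp Sum.inr)
    (mem_of_superset univ_mem fun y _ => y.2.2)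
  have hlp : Tendsto Prod.fst l (comap (G.tp Δ) (𝓝 p)) :=
    tendsto_comap_iff.2 ((continuous_fst.tendsto (p, q)).comp
      (tendsto_comap.mono_left inf_le_left))
  have hlq : Tendsto Prod.snd l (comap (G.tp Δ) (𝓝 q)) :=
    tendsto_comap_iff.2 ((continuous_snd.tendsto (p, q)).comp
      (tendsto_comap.mono_left inf_le_left))
  refine ⟨(⟨x ∘ Sum.inl, hd₁⟩, ⟨x ∘ Sum.inr, hd₂⟩), (hR _ _).2 fun S hS => ?_, Prod.ext
    (tp_eq_of_forall fun X hX => ?_) (tp_eq_of_forall fun X hX => ?_)⟩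
  · change Sum.elim (x ∘ Sum.inl) (x ∘ Sum.inr) ∈ S
    rw [Sum.elim_comp_inl_inr]
    refine hx' S (h𝒮 S hS) (mem_of_superset (mem_inf_of_right (mem_principal_self _)) ?_)
    exact fun y hy => (hR _ _).1 hy S hS
  · obtain ⟨S, hS, rfl⟩ := isDefinableOver_of_mem_deltaAlg (p.sets_subset X hX)
    exact hx' _ (hS.preimage_comp Sum.inl) (hlp (preimage_mem_comap_nhds hX))
  · obtain ⟨S, hS, rfl⟩ := isDefinableOver_of_mem_deltaAlg (q.sets_subset X hX)
    exact hx' _ (hS.preimage_comp Sum.inr) (hlq (preimage_mem_comap_nhds hX))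

end Saturated

/-- The relation on `G*` given by a closed relation on `S` is type-definable. -/
theorem isTypeDefinableRel_of_isClosed {Z : Set (G.TypeSpace Δ × G.TypeSpace Δ)}
    (hZ : IsClosed Z) : G.IsTypeDefinableRel fun a b => (G.tp Δ a, G.tp Δ b) ∈ Z := by
  refine ⟨{S | (M : Set C).Definable L S ∧
    ∀ a b : G.Star, (G.tp Δ a, G.tp Δ b) ∈ Z → Sum.elim a.1 b.1 ∈ S}, fun S hS => hS.1,
    fun a b => ⟨fun h S hS => hS.2 a b h, fun h => ?_⟩⟩
  by_contra hab
  obtain ⟨U, hU, V, hV, hUV⟩ := mem_nhds_prod_iff.1 (hZ.isOpen_compl.mem_nhds hab)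
  obtain ⟨X, hX, hXU⟩ := TypeSpace.mem_nhds_iff.1 hU
  obtain ⟨Y, hY, hYV⟩ := TypeSpace.mem_nhds_iff.1 hV
  obtain ⟨S, hS, rfl⟩ := isDefinableOver_of_mem_deltaAlg hX.1
  obtain ⟨T, hT, rfl⟩ := isDefinableOver_of_mem_deltaAlg hY.1
  refine h _ ⟨((hS.preimage_comp Sum.inl).inter (hT.preimage_comp Sum.inr)).compl, ?_⟩
    ⟨hX.2, hY.2⟩
  intro c d hcd hmem
  exact hUV (mk_mem_prod (hXU ((mem_tp_sets hX.1).2 hmem.1)) (hYV ((mem_tp_sets hY.1).2 hmem.2)))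
    hcd

/-! ### Coheirs and the relation `F₀` -/

/-- The identity has coordinates in `M`, so it adds no parameters and Tarski–Vaught suffices. -/
theorem isCoheir_one (a : G.Star) : G.IsCoheir Δ a 1 := by
  intro X hX ha
  refine IsDefinableOver.exists_mem_base
    ((isDefinableOver_of_dcl (isDefinableOver_of_mem_deltaAlg hX)).mono ?_) ⟨a, ha⟩
  refine union_subset Subset.rfl ?_
  rintro _ ⟨i, rfl⟩
  exact G.base.one_mem i

/-- Makes the projection to the quotient by `FBar` factor through the type space. -/
theorem F₀_of_tp_eq {a b : G.Star} (h : G.tp Δ a = G.tp Δ b) : G.F₀ Δ a b :=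
  ⟨a, 1, b, 1, (mul_one a).symm, (mul_one b).symm, h, rfl, isCoheir_one a, isCoheir_one b⟩

theorem tp_mul_left (g : G.base) {a b : G.Star} (h : G.tp Δ a = G.tp Δ b) :
    G.tp Δ (g * a) = G.tp Δ (g * b) :=
  tp_eq_tp_iff.2 fun _ hX ha => tp_eq_tp_iff.1 h _ (deltaAlg_mul_left_base g hX) ha

theorem IsCoheir.mul_left (g : G.base) {a b : G.Star} (h : G.IsCoheir Δ a b) :
    G.IsCoheir Δ (g * a) b := by
  intro X hX ha
  obtain ⟨k, hk, hkX⟩ := h _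
    (deltaAlg_mul_left (g := (g : G.Star)) (fun i => subset_dcl _ (Or.inl (g.2 i))) hX) ha
  exact ⟨g * k, G.base.mul_mem g.2 hk, hkX⟩

theorem F₀.mul_left (g : G.base) {a b : G.Star} (h : G.F₀ Δ a b) :
    G.F₀ Δ (g * a) (g * b) := by
  obtain ⟨a, b, a₁, b₁, rfl, rfl, ha, hb, hab, hab₁⟩ := h
  exact ⟨g * a, b, g * a₁, b₁, (mul_assoc _ _ _).symm, (mul_assoc _ _ _).symm, tp_mul_left g ha, hb,
    hab.mul_left g, hab₁.mul_left g⟩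

theorem mem_typeDefinableAbove_iff {R : Setoid G.Star} :
    R ∈ G.typeDefinableAbove Δ ↔
      G.IsTypeDefinableRel R ∧ ∀ a b, G.F₀ Δ a b → R a b := by
  refine and_congr_right fun _ => ⟨fun h a b hab => h a b (.single hab), fun h a b hab => ?_⟩
  induction hab with
  | single h' => exact h _ _ h'
  | tail _ h' ih => exact R.trans ih (h _ _ h')

theorem FBar_of_F₀ {a b : G.Star} (h : G.F₀ Δ a b) : G.FBar Δ a b :=
  (G.isLeast_FBar Δ).1.2 a b (.single h)

/-- The pullback of `FBar` under translation by `g` is again a type-definable equivalence relation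
containing `F₀`, so minimality applies. -/
theorem FBar_mul_left (g : G.base) {a b : G.Star} (h : G.FBar Δ a b) :
    G.FBar Δ (g * a) (g * b) := by
  have hR : (G.FBar Δ).comap (fun a => (g : G.Star) * a) ∈ G.typeDefinableAbove Δ := by
    refine mem_typeDefinableAbove_iff.2 ⟨?_, fun a b hab => FBar_of_F₀ (hab.mul_left g)⟩
    obtain ⟨𝒮, h𝒮, hS⟩ := (G.isLeast_FBar Δ).1.1
    have := fun S : 𝒮 => exists_definable_mul_left (h𝒮 S.1 S.2) (y := (g : G.Star)) g.2
    choose T hT hTS using this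
    refine ⟨range T, forall_mem_range.2 hT, fun a b => ?_⟩
    refine (hS _ _).trans ?_
    simp only [forall_mem_range, hTS, Subtype.forall]
  exact (G.isLeast_FBar Δ).2 hR h

/-- The action of `G` on `G*/F̄` by left translations. -/
noncomputable instance : MulAction G.base (Quotient (G.FBar Δ)) where
  smul g := Quotient.map (fun a => (g : G.Star) * a) fun _ _ => FBar_mul_left g
  one_smul := by
    rintro ⟨a⟩
    exact congrArg (Quotient.mk _) (one_mul a)
  mul_smul g k := by
    rintro ⟨a⟩
    exact congrArg (Quotient.mk _) (mul_assoc (g : G.Star) k a)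

theorem smul_mk (g : G.base) (a : G.Star) :
    g • Quotient.mk (G.FBar Δ) a = Quotient.mk (G.FBar Δ) (g * a) := rfl

/-! ### The quotient is compact Hausdorff -/

/-- A closed continuous image of a compact Hausdorff space is Hausdorff. -/
theorem t2Space_of_isClosedMap {S Q : Type*} [TopologicalSpace S] [TopologicalSpace Q]
    [CompactSpace S] [T2Space S] {f : S → Q} (hf : Continuous f) (hs : Function.Surjective f)
    (hc : IsClosedMap f) : T2Space Q where
  t2 x y hxy := by
    have hcl : ∀ z : Q, IsClosed (f ⁻¹' {z}) := fun z => by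
      obtain ⟨s, rfl⟩ := hs z
      rw [← image_singleton]
      exact (hc _ isClosed_singleton).preimage hf
    obtain ⟨U, V, hU, hV, hxU, hyV, hUV⟩ := normal_separation (hcl x) (hcl y)
      (Disjoint.preimage f (disjoint_singleton.2 hxy))
    refine ⟨kernImage f U, kernImage f V, isClosedMap_iff_kernImage.1 hc hU,
      isClosedMap_iff_kernImage.1 hc hV, fun s hs => hxU hs, fun s hs => hyV hs, ?_⟩
    refine disjoint_left.2 fun z hzU hzV => ?_
    obtain ⟨s, rfl⟩ := hs z
    exact disjoint_left.1 hUV (hzU rfl) (hzV rfl)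

section Saturated

variable {κ : Cardinal.{w}}

/-- The factorization of `G* → G*/F̄` through the space of types. -/
theorem exists_typeSpace_to_quotient (hM : Cardinal.mk M < κ) (hC : IsSaturated L C κ) :
    ∃ π : G.TypeSpace Δ → Quotient (G.FBar Δ), Continuous π ∧
      ∀ a, π (G.tp Δ a) = Quotient.mk _ a := by
  have hs := surjective_tp (G := G) (Δ := Δ) hM hC
  have h (a : G.Star) : Quotient.mk (G.FBar Δ) (Function.surjInv hs (G.tp Δ a)) =
      Quotient.mk (G.FBar Δ) a :=
    Quotient.sound (FBar_of_F₀ (F₀_of_tp_eq (Function.surjInv_eq hs _)))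
  refine ⟨fun p => Quotient.mk _ (Function.surjInv hs p), ?_, h⟩
  refine (isQuotientMap_tp hM hC).continuous_iff.2 ?_
  exact continuous_quotient_mk'.congr fun a => (h a).symm

theorem compactSpace_quotient (hM : Cardinal.mk M < κ) (hC : IsSaturated L C κ) :
    CompactSpace (Quotient (G.FBar Δ)) :=
  have := compactSpace_star (G := G) hM hC
  Quotient.compactSpace

theorem t2Space_quotient (hM : Cardinal.mk M < κ) (hC : IsSaturated L C κ) :
    T2Space (Quotient (G.FBar Δ)) := by
  have := compactSpace_typeSpace (G := G) (Δ := Δ) hM hC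
  obtain ⟨π, hπ, h⟩ := exists_typeSpace_to_quotient (G := G) (Δ := Δ) hM hC
  have hcomp : π ∘ G.tp Δ = Quotient.mk _ := funext h
  have hq : IsQuotientMap π := by
    refine IsQuotientMap.of_comp continuous_tp hπ ?_
    rw [hcomp]
    exact isQuotientMap_quotient_mk'
  refine t2Space_of_isClosedMap hπ hq.surjective fun Z hZ => ?_
  have hK := isClosed_image_rel (Δ := Δ) hM hC (G.isLeast_FBar Δ).1.1
  rw [← hq.isClosed_preimage]
  -- The preimage under `π` of the image of `Z` is the second projection of `K ∩ (Z × S)`, where `K`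
  -- is the closed image of `FBar` in `S × S`. Compactness makes this projection closed.
  convert! ((hK.inter (hZ.preimage continuous_fst)).isCompact.image continuous_snd).isClosed
  ext q
  constructor
  · rintro ⟨p, hp, hpq⟩
    obtain ⟨a, rfl⟩ := surjective_tp hM hC p
    obtain ⟨b, rfl⟩ := surjective_tp hM hC q
    rw [h, h] at hpq
    exact ⟨(G.tp Δ a, G.tp Δ b), ⟨⟨(a, b), Quotient.exact hpq, rfl⟩, hp⟩, rfl⟩
  · rintro ⟨_, ⟨⟨⟨a, b⟩, hab, rfl⟩, hp⟩, rfl⟩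
    refine ⟨G.tp Δ a, hp, ?_⟩
    change π (G.tp Δ a) = π (G.tp Δ b)
    rw [h, h]
    exact Quotient.sound hab

/-! ### The quotient is an ambit -/

theorem mk_union_range_lt (hκ : Cardinal.aleph0 ≤ κ) (hM : Cardinal.mk M < κ) (b : Fin n → C) :
    Cardinal.mk ((M : Set C) ∪ range b : Set C) < κ :=
  (Cardinal.mk_union_le _ _).trans_lt (Cardinal.add_lt_of_lt hκ hM
    ((Cardinal.lt_aleph0_of_finite _).trans_le hκ))

/-- A type in the closure of a set of elements of `G` has a realization which is a coheir and
belongs to all definable sets containing this set. -/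
theorem exists_coheir_realization (hκ : Cardinal.aleph0 ≤ κ) (hM : Cardinal.mk M < κ)
    (hC : IsSaturated L C κ) {A : Set G.Star} (hA : A ⊆ G.base) {p : G.TypeSpace Δ}
    (hp : p ∈ closure (G.tp Δ '' A)) (b : G.Star) :
    ∃ a, G.tp Δ a = p ∧ G.IsCoheir Δ a b ∧
      ∀ X, G.IsDefinableOver ((M : Set C) ∪ range b.1) X → A ⊆ X → a ∈ X := by
  let l : Filter G.Star := comap (G.tp Δ) (𝓝 p) ⊓ 𝓟 A
  have hl : l.NeBot := by
    rw [← map_neBot_iff (G.tp Δ), Filter.push_pull', map_principal]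
    exact mem_closure_iff_clusterPt.1 hp
  obtain ⟨a, ha⟩ := exists_forall_mem hC (mk_union_range_lt hκ hM b.1) l
  have ha' (X : Set G.Star) (hX : G.IsDefinableOver ((M : Set C) ∪ range b.1) X) (h : A ⊆ X) :
      a ∈ X := ha X (mem_of_superset (mem_inf_of_right (mem_principal_self A)) h) hX
  refine ⟨a, tp_eq_of_forall fun X hX => ?_, fun X hX haX => ?_, ha'⟩
  · exact ha X (mem_inf_of_left (preimage_mem_comap_nhds hX))
      ((isDefinableOver_of_mem_deltaAlg (p.sets_subset X hX)).mono subset_union_left)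
  -- If `X` missed `G`, its complement would be a definable set containing `A`, hence containing
  -- `a`.
  · by_contra! hc
    exact ha' Xᶜ (isDefinableOver_of_dcl (isDefinableOver_of_mem_deltaAlg hX)).compl
      (fun g hg => hc g (hA hg)) haX

/-- By compactness, finitely many basic clopen sets missing `Z₂` cover `Z₁`. -/
theorem exists_deltaAlg_separation (hM : Cardinal.mk M < κ) (hC : IsSaturated L C κ)
    {Z₁ Z₂ : Set (G.TypeSpace Δ)} (h₁ : IsClosed Z₁) (h₂ : IsClosed Z₂) (h : Disjoint Z₁ Z₂) :
    ∃ D ∈ G.deltaAlg Δ M, ∀ a, (G.tp Δ a ∈ Z₁ → a ∈ D) ∧ (G.tp Δ a ∈ Z₂ → a ∉ D) := by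
  have := compactSpace_typeSpace (G := G) (Δ := Δ) hM hC
  have key : ∃ D ∈ G.deltaAlg Δ M, (∀ a, G.tp Δ a ∈ Z₁ → a ∈ D) ∧
      ∀ a, G.tp Δ a ∈ Z₂ → a ∉ D := by
    refine h₁.isCompact.induction_on (p := fun Z => ∃ D ∈ G.deltaAlg Δ M,
      (∀ a, G.tp Δ a ∈ Z → a ∈ D) ∧ ∀ a, G.tp Δ a ∈ Z₂ → a ∉ D)
      ⟨∅, BooleanSubalgebra.bot_mem, by simp, by simp⟩ ?_ ?_ ?_
    · rintro Z Z' hZ ⟨D, hD, hD₁, hD₂⟩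
      exact ⟨D, hD, fun a ha => hD₁ a (hZ ha), hD₂⟩
    · rintro Z Z' ⟨D, hD, hD₁, hD₂⟩ ⟨D', hD', hD₁', hD₂'⟩
      exact ⟨D ∪ D', BooleanSubalgebra.sup_mem hD hD', fun a => Or.imp (hD₁ a) (hD₁' a),
        fun a ha => not_or.2 ⟨hD₂ a ha, hD₂' a ha⟩⟩
    · intro p hp
      obtain ⟨X, hX, hXZ⟩ :=
        TypeSpace.mem_nhds_iff.1 (h₂.isOpen_compl.mem_nhds (disjoint_left.1 h hp))
      have hX' := p.sets_subset X hX
      exact ⟨_, mem_nhdsWithin_of_mem_nhds (TypeSpace.mem_nhds_iff.2 ⟨X, hX, Subset.rfl⟩), X, hX',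
        fun a ha => (mem_tp_sets hX').1 ha, fun a ha haX => hXZ ((mem_tp_sets hX').2 haX) ha⟩
  obtain ⟨D, hD, hD₁, hD₂⟩ := key
  exact ⟨D, hD, fun a => ⟨hD₁ a, hD₂ a⟩⟩

/-- A type in the closures of both traces would have coheir realizations `a` and `a'` over `b`, with
the classes of `a * b` and `a' * b` in the disjoint sets `C₁` and `C₂`. But these products are
related by `F₀`. -/
theorem isDeltaDefinable_smul (hκ : Cardinal.aleph0 ≤ κ) (hM : Cardinal.mk M < κ)
    (hC : IsSaturated L C κ) (x : Quotient (G.FBar Δ)) :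
    G.IsDeltaDefinable Δ fun g => g • x := by
  intro C₁ C₂ h₁ h₂ h
  obtain ⟨b, rfl⟩ := Quotient.exists_rep x
  let A (D : Set (Quotient (G.FBar Δ))) : Set G.Star := {g | g ∈ G.base ∧ Quotient.mk _ (g * b) ∈ D}
  have key (D : Set (Quotient (G.FBar Δ))) (hD : IsClosed D) (p : G.TypeSpace Δ)
      (hp : p ∈ closure (G.tp Δ '' A D)) :
      ∃ a, G.tp Δ a = p ∧ G.IsCoheir Δ a b ∧ Quotient.mk (G.FBar Δ) (a * b) ∈ D := by
    obtain ⟨a, ha, hab, h⟩ := exists_coheir_realization hκ hM hC (fun g hg => hg.1) hp b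
    refine ⟨a, ha, hab, (mem_closed_iff (hD.preimage continuous_quotient_mk')).2 ?_⟩
    intro X hX hDX
    exact h _ ((hX.mono subset_union_left).mul_right fun i => Or.inr ⟨i, rfl⟩)
      fun g hg => hDX hg.2
  have hdisj : Disjoint (closure (G.tp Δ '' A C₁)) (closure (G.tp Δ '' A C₂)) := by
    refine disjoint_left.2 fun p hp₁ hp₂ => ?_
    obtain ⟨a, ha, hab, haC⟩ := key C₁ h₁ p hp₁
    obtain ⟨a', ha', hab', haC'⟩ := key C₂ h₂ p hp₂
    refine disjoint_left.1 h haC ?_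
    rwa [Quotient.sound (s := G.FBar Δ)
      (FBar_of_F₀ ⟨a, b, a', b, rfl, rfl, ha.trans ha'.symm, rfl, hab, hab'⟩)]
  obtain ⟨D, hD, h⟩ := exists_deltaAlg_separation hM hC isClosed_closure isClosed_closure hdisj
  exact ⟨D, hD, fun g => ⟨fun hg => (h g).1 (subset_closure ⟨g, ⟨g.2, hg⟩, rfl⟩),
    fun hg => (h g).2 (subset_closure ⟨g, ⟨g.2, hg⟩, rfl⟩)⟩⟩

theorem isDeltaAmbit_quotient (hκ : Cardinal.aleph0 ≤ κ) (hM : Cardinal.mk M < κ)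
    (hC : IsSaturated L C κ) :
    G.IsDeltaAmbit Δ (Quotient (G.FBar Δ)) (Quotient.mk (G.FBar Δ) 1) where
  compactSpace := compactSpace_quotient hM hC
  t2Space := t2Space_quotient hM hC
  continuous_smul g :=
    isQuotientMap_quotient_mk'.continuous_iff.2
      (continuous_quotient_mk'.comp (continuous_mul_left g))
  dense_orbit := by
    have h := Quotient.mk_surjective.denseRange.dense_image
      (continuous_quotient_mk' (s := G.FBar Δ)) (dense_base (G := G))
    refine h.mono ?_
    rintro _ ⟨g, hg, rfl⟩
    exact ⟨⟨g, hg⟩, congrArg (Quotient.mk _) (mul_one g)⟩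
  definable := isDeltaDefinable_smul hκ hM hC

end Saturated

/-! ### Prolongations -/

theorem denseRange_tp_base : DenseRange fun g : G.base => G.tp Δ g := by
  intro p
  refine mem_closure_iff_nhds.2 fun U hU => ?_
  obtain ⟨X, hX, h⟩ := TypeSpace.mem_nhds_iff.1 hU
  have hX' := p.sets_subset X hX
  obtain ⟨g, hg, hgX⟩ :=
    (isDefinableOver_of_mem_deltaAlg hX').exists_mem_base (p.nonempty_of_mem hX)
  exact ⟨_, h ((mem_tp_sets hX').2 hgX), ⟨g, hg⟩, rfl⟩

/-- A `Δ`-definable map from `G` to a compact Hausdorff space extends to the space of types. -/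
theorem IsDeltaDefinable.exists_extension {Y : Type*} [TopologicalSpace Y] [CompactSpace Y]
    [T2Space Y] {f : G.base → Y} (hf : G.IsDeltaDefinable Δ f) :
    ∃ F : G.TypeSpace Δ → Y, Continuous F ∧ ∀ g : G.base, F (G.tp Δ g) = f g := by
  let i : G.base → G.TypeSpace Δ := fun g => G.tp Δ g
  -- `G` carries the topology induced from the type space, so the extension theorem for dense
  -- inducing maps applies. Injectivity of `i` is not needed.
  let _ : TopologicalSpace G.base := .induced i inferInstance
  have hi : IsDenseInducing i := ⟨⟨rfl⟩, denseRange_tp_base⟩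
  have hlim (p : G.TypeSpace Δ) : ∃ c, Tendsto f (comap i (𝓝 p)) (𝓝 c) := by
    have := hi.comap_nhds_neBot p
    obtain ⟨c, hc⟩ := exists_clusterPt_of_compactSpace (map f (comap i (𝓝 p)))
    refine ⟨c, le_nhds_of_unique_clusterPt fun d hd => ?_⟩
    by_contra hcd
    -- Two distinct cluster points would have neighbourhoods with disjoint closures, separated by
    -- some `D`. The type `p` decides `D`, which excludes one of the two points.
    obtain ⟨U, hcU, hU, V, hdV, hV, hUV⟩ := exists_open_nhds_disjoint_closure (Ne.symm hcd)
    obtain ⟨D, hD, hsep⟩ := hf _ _ isClosed_closure isClosed_closure hUV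
    by_cases hp : D ∈ p.sets
    · have h : ∀ᶠ g : G.base in comap i (𝓝 p), (g : G.Star) ∈ D :=
        ⟨_, TypeSpace.mem_nhds_iff.2 ⟨D, hp, Subset.rfl⟩, fun g hg => hg.2⟩
      obtain ⟨g, hg₁, hg₂⟩ := ((frequently_map.1 (hd.frequently (hV.mem_nhds hdV))).and_eventually
        h).exists
      exact (hsep g).2 (subset_closure hg₁) hg₂
    · have hp' := (p.compl_mem_iff D hD).2 hp
      have h : ∀ᶠ g : G.base in comap i (𝓝 p), (g : G.Star) ∈ Dᶜ :=
        ⟨_, TypeSpace.mem_nhds_iff.2 ⟨Dᶜ, hp', Subset.rfl⟩, fun g hg => hg.2⟩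
      obtain ⟨g, hg₁, hg₂⟩ := ((frequently_map.1 (hc.frequently (hU.mem_nhds hcU))).and_eventually
        h).exists
      exact hg₂ ((hsep g).1 (subset_closure hg₁))
  exact ⟨hi.extend f, hi.continuous_extend hlim, hi.extend_eq' hlim⟩

theorem isDeltaDefinableStar_comp_tp {Y : Type*} [TopologicalSpace Y] {F : G.TypeSpace Δ → Y}
    (hF : Continuous F) : G.IsDeltaDefinableStar Δ fun a => F (G.tp Δ a) := by
  intro Z hZ
  refine ⟨{X | X ∈ G.deltaAlg Δ M ∧ (fun a => F (G.tp Δ a)) ⁻¹' Z ⊆ X}, fun X hX => hX.1,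
    Subset.antisymm (subset_sInter fun X hX => hX.2) fun a ha => ?_⟩
  by_contra hc
  obtain ⟨X, hX, h⟩ := TypeSpace.mem_nhds_iff.1 ((hZ.preimage hF).isOpen_compl.mem_nhds hc)
  refine ha Xᶜ ⟨BooleanSubalgebra.compl_mem hX.1, fun b hb hbX => ?_⟩ hX.2
  exact h ((mem_tp_sets hX.1).2 hbX) hb

/-! ### Maps to ambits -/

section Ambit

variable {Y : Type*} [TopologicalSpace Y] [MulAction G.base Y] {y₀ : Y}

theorem IsDeltaAmbit.exists_extension (hY : G.IsDeltaAmbit Δ Y y₀) (y : Y) :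
    ∃ F : G.TypeSpace Δ → Y, Continuous F ∧ ∀ g : G.base, F (G.tp Δ g) = g • y :=
  have := hY.compactSpace
  have := hY.t2Space
  (hY.definable y).exists_extension

variable {F : G.TypeSpace Δ → Y}

/-- Both sides are continuous in `b` and agree on the dense subgroup `G`. -/
theorem IsDeltaAmbit.extension_mul_left (hY : G.IsDeltaAmbit Δ Y y₀) (hF : Continuous F)
    (h : ∀ g : G.base, F (G.tp Δ g) = g • y₀) (g : G.base) (b : G.Star) :
    F (G.tp Δ (g * b)) = g • F (G.tp Δ b) := by
  have := hY.t2Space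
  refine congrFun (Continuous.ext_on dense_base
    ((hF.comp continuous_tp).comp (continuous_mul_left g))
    ((hY.continuous_smul g).comp (hF.comp continuous_tp)) fun k hk => ?_) b
  have h₁ := h (g * ⟨k, hk⟩)
  have h₂ := h ⟨k, hk⟩
  rw [mul_smul, ← h₂] at h₁
  exact h₁

/-- For `a` in `G` this is equivariance. A failure at `a` would be witnessed by a `Δ`-definable set
over `dcl` of `M` and `b`. By the coheir condition some `g` in `G` lies in this set, and the
equality would fail at `g`. -/
theorem IsDeltaAmbit.extension_mul_of_isCoheir (hY : G.IsDeltaAmbit Δ Y y₀) (hF : Continuous F)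
    (h : ∀ g : G.base, F (G.tp Δ g) = g • y₀) {a b : G.Star} (hab : G.IsCoheir Δ a b)
    {F' : G.TypeSpace Δ → Y} (hF' : Continuous F')
    (h' : ∀ g : G.base, F' (G.tp Δ g) = g • F (G.tp Δ b)) :
    F (G.tp Δ (a * b)) = F' (G.tp Δ a) := by
  have := hY.t2Space
  by_contra hne
  obtain ⟨U, V, hU, hV, haU, haV, hUV⟩ := t2_separation hne
  obtain ⟨W, hW, hWU⟩ := TypeSpace.mem_nhds_iff.1 ((hU.preimage hF).mem_nhds haU)
  obtain ⟨Z, hZ, hZV⟩ := TypeSpace.mem_nhds_iff.1 ((hV.preimage hF').mem_nhds haV)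
  have hZ' : Z ∈ G.deltaAlg Δ (dcl L ((M : Set C) ∪ range b.1)) :=
    deltaAlg_mono (subset_union_left.trans (subset_dcl _)) hZ.1
  obtain ⟨g, hg, hgW, hgZ⟩ := hab _
    (BooleanSubalgebra.inf_mem (deltaAlg_mul_right b hW.1) hZ') ⟨hW.2, hZ.2⟩
  have h₁ : F (G.tp Δ (g * b)) ∈ U := hWU ((mem_tp_sets hW.1).2 hgW)
  have h₂ : F' (G.tp Δ g) ∈ V := hZV ((mem_tp_sets hZ.1).2 hgZ)
  rw [hY.extension_mul_left hF h ⟨g, hg⟩ b, ← h' ⟨g, hg⟩] at h₁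
  exact disjoint_left.1 hUV h₁ h₂

theorem IsDeltaAmbit.extension_eq_of_FBar (hY : G.IsDeltaAmbit Δ Y y₀) (hF : Continuous F)
    (h : ∀ g : G.base, F (G.tp Δ g) = g • y₀) {a b : G.Star} (hab : G.FBar Δ a b) :
    F (G.tp Δ a) = F (G.tp Δ b) := by
  have := hY.t2Space
  have hR : Setoid.ker (fun a => F (G.tp Δ a)) ∈ G.typeDefinableAbove Δ := by
    refine mem_typeDefinableAbove_iff.2 ⟨?_, ?_⟩
    · exact isTypeDefinableRel_of_isClosed
        (isClosed_eq (hF.comp continuous_fst) (hF.comp continuous_snd))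
    · rintro _ _ ⟨a, b, a₁, b₁, rfl, rfl, ha, hb, hab, hab₁⟩
      -- One `F'` serves both products, since `b` and `b₁` have the same type.
      obtain ⟨F', hF', h'⟩ := hY.exists_extension (F (G.tp Δ b))
      change F (G.tp Δ (a * b)) = F (G.tp Δ (a₁ * b₁))
      rw [hY.extension_mul_of_isCoheir hF h hab hF' h',
        hY.extension_mul_of_isCoheir hF h hab₁ hF' (hb ▸ h'), ha]
  exact (G.isLeast_FBar Δ).2 hR hab

theorem IsDeltaAmbit.existsUnique_hom (hY : G.IsDeltaAmbit Δ Y y₀) {κ : Cardinal.{w}}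
    (hκ : Cardinal.aleph0 ≤ κ) (hM : Cardinal.mk M < κ) (hC : IsSaturated L C κ) :
    ∃! f : Quotient (G.FBar Δ) → Y, Continuous f ∧
      (∀ (g : G.base) (x : Quotient (G.FBar Δ)), f (g • x) = g • f x) ∧
      f (Quotient.mk (G.FBar Δ) 1) = y₀ := by
  have := hY.t2Space
  obtain ⟨F, hF, h⟩ := hY.exists_extension y₀
  refine ⟨Quotient.lift (fun a => F (G.tp Δ a)) fun _ _ => hY.extension_eq_of_FBar hF h,
    ⟨(hF.comp continuous_tp).quotient_lift _, ?_, ?_⟩, ?_⟩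
  · rintro g ⟨a⟩
    exact hY.extension_mul_left hF h g a
  · exact (h 1).trans (one_smul _ _)
  · rintro f ⟨hf, hfs, hf₁⟩
    refine Continuous.ext_on (isDeltaAmbit_quotient hκ hM hC).dense_orbit hf
      ((hF.comp continuous_tp).quotient_lift _) ?_
    rintro _ ⟨g, rfl⟩
    change f (g • _) = F (G.tp Δ (g * 1))
    rw [hfs, hf₁, mul_one, h]

end Ambit

/-! ### Universality and comparison with `E'`. -/

theorem isUniversalDeltaAmbit_quotient {κ : Cardinal.{w}} (hκ : Cardinal.aleph0 ≤ κ)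
    (hM : Cardinal.mk M < κ) (hC : IsSaturated L C κ) :
    IsUniversalDeltaAmbit.{u, v, w, w, t} G Δ (Quotient (G.FBar Δ))
      (Quotient.mk (G.FBar Δ) 1) where
  toIsDeltaAmbit := isDeltaAmbit_quotient hκ hM hC
  exists_unique_hom _ _ _ _ hY := hY.existsUnique_hom hκ hM hC

/-- Types of elements of `G` are dense, so the map quantified in `E` is unique and may be replaced
by any given extension. -/
theorem E_iff {U : Type*} [TopologicalSpace U] [T2Space U] [MulAction G.base U] {x : U}
    {F : G.TypeSpace Δ → U} (hF : Continuous F) (h : ∀ g : G.base, F (G.tp Δ g) = g • x)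
    {p q : G.TypeSpace Δ} : G.E Δ U x p q ↔ F p = F q := by
  refine ⟨fun ⟨F', hF', h', hpq⟩ => ?_,
    fun hpq => ⟨F, hF, ⟨isDeltaDefinableStar_comp_tp hF, h⟩, hpq⟩⟩
  have : F' = F := denseRange_tp_base.equalizer hF' hF (funext fun g => (h'.2 g).trans (h g).symm)
  rwa [← this]

theorem FBar_iff_E' {U : Type s} [TopologicalSpace U] [MulAction G.base U] {x : U}
    {κ : Cardinal.{w}} (hκ : Cardinal.aleph0 ≤ κ) (hM : Cardinal.mk M < κ)
    (hC : IsSaturated L C κ) (hU : IsUniversalDeltaAmbit.{u, v, w, s, w} G Δ U x)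
    (a b : G.Star) : G.FBar Δ a b ↔ G.E' Δ U x a b := by
  have := hU.t2Space
  have hQ := isDeltaAmbit_quotient (G := G) (Δ := Δ) hκ hM hC
  have := hQ.t2Space
  obtain ⟨F, hF, h⟩ := hU.toIsDeltaAmbit.exists_extension x
  refine Iff.trans ⟨hU.toIsDeltaAmbit.extension_eq_of_FBar hF h, fun hab => ?_⟩ (E_iff hF h).symm
  obtain ⟨f, ⟨hf, hfs, hfx⟩, -⟩ := hU.exists_unique_hom _ _ hQ
  obtain ⟨π, hπ, hπa⟩ := exists_typeSpace_to_quotient (G := G) (Δ := Δ) hM hC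
  -- By equivariance both maps send the type of `g` to the class of `g`, and such types are dense.
  have hfF : f ∘ F = π := denseRange_tp_base.equalizer (hf.comp hF) hπ (funext fun g => by
    change f (F (G.tp Δ g)) = π (G.tp Δ g)
    rw [h, hfs, hfx, hπa, smul_mk, mul_one])
  refine Quotient.exact (s := G.FBar Δ) ?_
  rw [← hπa, ← hπa, ← hfF]
  exact congrArg f hab

end DefinableGroup

end DeltaFlow

theorem mainTheorem1 {L : FirstOrder.Language.{u, v}} {C : Type w} [L.Structure C]
    (M : L.ElementarySubstructure C)
    (κ : Cardinal.{w}) (hκ : Cardinal.aleph0 ≤ κ) (hM : Cardinal.mk M < κ)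
    (hC : DeltaFlow.IsSaturated L C κ)
    {n : ℕ} (G : DeltaFlow.DefinableGroup M n)
    (Δ : Set (Σ m : ℕ, L.Formula (Fin n ⊕ Fin m))) :
    (∀ (U : Type s) [TopologicalSpace U] [MulAction G.base U] (x : U),
      DeltaFlow.DefinableGroup.IsUniversalDeltaAmbit.{u, v, w, s, w} G Δ U x →
      ∀ a b : G.Star, G.FBar Δ a b ↔ G.E' Δ U x a b) ∧
    (letI : TopologicalSpace (Quotient (G.FBar Δ)) := G.logicTopology (G.FBar Δ)
      ∃ _ : MulAction G.base (Quotient (G.FBar Δ)),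
        (∀ (g : G.base) (a : G.Star),
          g • (Quotient.mk (G.FBar Δ) a) = Quotient.mk (G.FBar Δ) ((g : G.Star) * a)) ∧
        DeltaFlow.DefinableGroup.IsUniversalDeltaAmbit.{u, v, w, w, t} G Δ
          (Quotient (G.FBar Δ)) (Quotient.mk (G.FBar Δ) 1)) :=
  -- The logic topology is by definition the quotient of the type-definable topology, which the
  -- preceding lemmas use as the instance.
  ⟨fun _ _ _ _ hU => DeltaFlow.DefinableGroup.FBar_iff_E' hκ hM hC hU,
    inferInstance, DeltaFlow.DefinableGroup.smul_mk,
    DeltaFlow.DefinableGroup.isUniversalDeltaAmbit_quotient hκ hM hC⟩
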